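/- Regard $L^2(\mathbb{R}_+)$ as the closed subspace of $L^2(\mathbb{R})$ (complex-valued functions) consisting of the functions that vanish a.e. on $(-\infty,0)$, and for a bounded operator $A$ on $L^2(\mathbb{R})$ that leaves $L^2(\mathbb{R}_+)$ invariant let $A_+$ be its restriction to $L^2(\mathbb{R}_+)$. For $K:\mathbb{R}\to\mathbb{C}$ with $K(u)|u|^{-1/2}\in L^1(\mathbb{R})$ let $\mathcal{H}_K$ be the bounded (Hausdorff) operator on $L^2(\mathbb{R})$ given by $(\mathcal{H}_Kf)(x)=\int_{\mathbb{R}}K(u)f(ux)\,du$; it leaves $L^2(\mathbb{R}_+)$ invariant if $K=0$ a.e. on $(-\infty,0)$. The Cesàro operator is $\mathcal{C}=\mathcal{H}_{\chi_{(0,1)}}$, that is, $(\mathcal{C}f)(x)=\frac1x\int_0^xf(t)\,dt=\int_0^1 f(ux)\,du$, and $\mathcal{C}_+$ is its restriction to $L^2(\mathbb{R}_+)$. Let $\mathbb{T}+1=\{\lambda\in\mathbb{C}:|\lambda-1|=1\}$, and let $(\mathcal{M}K)(z)=\int_0^\infty K(u)u^{z-1}\,du$ denote the Mellin transform. The spectrum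 of $\mathcal{C}_+$ is contained in $\mathbb{T}+1$. Hence, for $F$ holomorphic in an open neighbourhood $N$ of $\mathbb{T}+1$, the operator $$F(\mathcal{C}_+)=\frac{1}{2\pi i}\int_{\Gamma}F(\lambda)(\lambda I-\mathcal{C}_+)^{-1}\,d\lambda$$ is defined, where $\Gamma$ is the positively oriented boundary of any annulus $\{r<|\lambda-1|<R\}$, $0<r<1<R$, whose closure lies in $N$. **Theorem.** Let $F$ be holomorphic in an open neighbourhood of $\mathbb{T}+1$. For a function $K:\mathbb{R}\to\mathbb{C}$ consider the conditions (a) $K(u)=0$ for a.e. $u<0$; (b) $K(u)u^{-1/2}\in L^1(\mathbb{R}_+)$; (c) $(\mathcal{M}K)(z)=F(z^{-1})$ for all $z\in\mathbb{C}$ with $\mathrm{Re}(z)=\frac12$. 1) If $F(0)=0$, then there is a measurable function $K$ such that (a), (b) and (c) hold and $F(\mathcal{C}_+)=(\mathcal{H}_K)_+$. 2) Conversely, if a function $K$ satisfies (a), (b) and (c), then $F(0)=0$ and $(\mathcal{H}_K)_+=F(\mathcal{C}_+)$. -/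

import Mathlib

open MeasureTheory Set
open scoped ENNReal

/-- The complex Hilbert space `L²(ℝ)`. -/
abbrev L2R : Type := Lp ℂ 2 (volume : Measure ℝ)

/-! ### Hausdorff operators on `L²(ℝ)` -/

/-- The condition `K(u)|u|^{-1/2} ∈ L¹(ℝ)` on a kernel `K`. -/
def IsHausdorffKernel (K : ℝ → ℂ) : Prop :=
  Integrable (fun u : ℝ => K u * ((|u| ^ (-1 / 2 : ℝ) : ℝ) : ℂ))

lemma ae_ne_zero_real : ∀ᵐ u : ℝ, u ≠ 0 := by
  simp [ae_iff, measure_singleton]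

lemma IsHausdorffKernel.aestronglyMeasurable {K : ℝ → ℂ} (hK : IsHausdorffKernel K) :
    AEStronglyMeasurable K := by
  have h1 : AEStronglyMeasurable (fun u : ℝ => (((|u| ^ (-1 / 2 : ℝ))⁻¹ : ℝ) : ℂ)) := by
    apply Measurable.aestronglyMeasurable
    fun_prop
  refine ((Integrable.aestronglyMeasurable hK).mul h1).congr ?_
  filter_upwards [ae_ne_zero_real] with u hu
  have : ((|u| ^ (-1 / 2 : ℝ) : ℝ) : ℂ) ≠ 0 := by
    exact_mod_cast (Real.rpow_pos_of_pos (abs_pos.mpr hu) _).ne'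
  simp only [Pi.mul_apply]
  rw [Complex.ofReal_inv, mul_assoc, mul_inv_cancel₀ this, mul_one]

lemma lintegral_sq_comp_mul (φ : ℝ → ℝ≥0∞) (hφ : Measurable φ) {u : ℝ} (hu : u ≠ 0) :
    ∫⁻ x, φ (u * x) ^ 2 = ENNReal.ofReal |u⁻¹| * ∫⁻ x, φ x ^ 2 := by
  have h := lintegral_map (μ := volume) (f := fun x => φ x ^ 2) (g := fun x => u * x)
    (by fun_prop) (by fun_prop)
  rw [Real.map_volume_mul_left hu, lintegral_smul_measure] at h
  exact h.symm

/-- Schur-type bound for the positive operator with kernel `k`. -/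
lemma lintegral_hausdorff_sq_le (k φ : ℝ → ℝ≥0∞) (hk : AEMeasurable k) (hφ : Measurable φ) :
    ∫⁻ x, (∫⁻ u, k u * φ (u * x)) ^ 2 ≤
      (∫⁻ u, k u * ENNReal.ofReal (|u| ^ (-1 / 2 : ℝ))) ^ 2 * ∫⁻ x, φ x ^ 2 := by
  set M := ∫⁻ u, k u * ENNReal.ofReal (|u| ^ (-1 / 2 : ℝ)) with hM
  have hpt : ∀ x, (∫⁻ u, k u * φ (u * x)) ^ 2 ≤
      M * ∫⁻ u, k u * ENNReal.ofReal (|u| ^ (1 / 2 : ℝ)) * φ (u * x) ^ 2 := by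
    intro x
    have h := ENNReal.lintegral_mul_norm_pow_le (μ := (volume : Measure ℝ))
      (f := fun u => k u * ENNReal.ofReal (|u| ^ (-1 / 2 : ℝ)))
      (g := fun u => k u * ENNReal.ofReal (|u| ^ (1 / 2 : ℝ)) * φ (u * x) ^ 2)
      (by fun_prop) (by fun_prop) (p := 1 / 2) (q := 1 / 2)
      (by norm_num) (by norm_num) (by norm_num)
    have h2 : ∫⁻ u, k u * φ (u * x) =
        ∫⁻ u, (k u * ENNReal.ofReal (|u| ^ (-1 / 2 : ℝ))) ^ (1 / 2 : ℝ) *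
          (k u * ENNReal.ofReal (|u| ^ (1 / 2 : ℝ)) * φ (u * x) ^ 2) ^ (1 / 2 : ℝ) := by
      apply lintegral_congr_ae
      filter_upwards [ae_ne_zero_real] with u hu
      have hpos : 0 < |u| := abs_pos.mpr hu
      rw [← ENNReal.mul_rpow_of_nonneg _ _ (by norm_num : (0 : ℝ) ≤ 1 / 2)]
      have h3 : ENNReal.ofReal (|u| ^ (-1 / 2 : ℝ)) * ENNReal.ofReal (|u| ^ (1 / 2 : ℝ)) = 1 := by
        rw [← ENNReal.ofReal_mul (by positivity), ← Real.rpow_add hpos]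
        norm_num
      have h4 : k u * ENNReal.ofReal (|u| ^ (-1 / 2 : ℝ)) *
          (k u * ENNReal.ofReal (|u| ^ (1 / 2 : ℝ)) * φ (u * x) ^ 2) =
          (k u * φ (u * x)) ^ (2 : ℝ) := by
        rw [ENNReal.rpow_two]
        calc _ = (ENNReal.ofReal (|u| ^ (-1 / 2 : ℝ)) * ENNReal.ofReal (|u| ^ (1 / 2 : ℝ))) *
              (k u * φ (u * x)) ^ 2 := by ring
          _ = _ := by rw [h3, one_mul]
      rw [h4, ← ENNReal.rpow_mul]
      norm_num
    rw [h2]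
    calc _ ≤ _ := pow_le_pow_left' h 2
      _ = _ := by
        rw [← ENNReal.rpow_two, ENNReal.mul_rpow_of_nonneg _ _ (by norm_num : (0 : ℝ) ≤ 2),
          ← ENNReal.rpow_mul, ← ENNReal.rpow_mul, ← hM, (by norm_num : (1 / 2 : ℝ) * 2 = 1),
          ENNReal.rpow_one, ENNReal.rpow_one]
  calc ∫⁻ x, (∫⁻ u, k u * φ (u * x)) ^ 2
      ≤ ∫⁻ x, M * ∫⁻ u, k u * ENNReal.ofReal (|u| ^ (1 / 2 : ℝ)) * φ (u * x) ^ 2 :=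
        lintegral_mono hpt
    _ = M * ∫⁻ x, ∫⁻ u, k u * ENNReal.ofReal (|u| ^ (1 / 2 : ℝ)) * φ (u * x) ^ 2 := by
        apply lintegral_const_mul''
        apply AEMeasurable.lintegral_prod_right'
          (f := fun p : ℝ × ℝ => k p.2 * ENNReal.ofReal (|p.2| ^ (1 / 2 : ℝ)) * φ (p.2 * p.1) ^ 2)
        have := hk.comp_snd (μ := (volume : Measure ℝ))
        fun_prop
    _ = M * ∫⁻ u, ∫⁻ x, k u * ENNReal.ofReal (|u| ^ (1 / 2 : ℝ)) * φ (u * x) ^ 2 := by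
        rw [lintegral_lintegral_swap]
        have := hk.comp_snd (μ := (volume : Measure ℝ))
        unfold Function.uncurry
        fun_prop
    _ = M * ∫⁻ u, (k u * ENNReal.ofReal (|u| ^ (-1 / 2 : ℝ))) * ∫⁻ x, φ x ^ 2 := by
        congr 1
        apply lintegral_congr_ae
        filter_upwards [ae_ne_zero_real] with u hu
        have hpos : 0 < |u| := abs_pos.mpr hu
        rw [lintegral_const_mul _ (by fun_prop), lintegral_sq_comp_mul φ hφ hu, ← mul_assoc,
          mul_assoc (k u), ← ENNReal.ofReal_mul (by positivity), abs_inv, ← Real.rpow_neg_one |u|,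
          ← Real.rpow_add hpos]
        norm_num
    _ = M ^ 2 * ∫⁻ x, φ x ^ 2 := by
        rw [lintegral_mul_const'' _ (by fun_prop), ← hM]
        ring

/-- The pointwise formula `(𝓗_K f)(x) = ∫_ℝ K(u) f(ux) du`. -/
noncomputable def hausdorffFun (K f : ℝ → ℂ) (x : ℝ) : ℂ :=
  ∫ u : ℝ, K u * f (u * x)

lemma hausdorffFun_congr (K : ℝ → ℂ) {f g : ℝ → ℂ} (h : f =ᵐ[volume] g) :
    hausdorffFun K f =ᵐ[volume] hausdorffFun K g := by
  filter_upwards [ae_ne_zero_real] with x hx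
  apply integral_congr_ae
  have hq : Measure.QuasiMeasurePreserving (fun u : ℝ => u * x) volume volume := by
    refine ⟨by fun_prop, ?_⟩
    rw [Real.map_volume_mul_right hx]
    exact Measure.smul_absolutelyContinuous
  filter_upwards [hq.ae h] with u hu
  simp only [hu]

lemma hausdorff_lintegral_lt_top {K : ℝ → ℂ} (hK : IsHausdorffKernel K) :
    ∫⁻ u, ‖K u‖ₑ * ENNReal.ofReal (|u| ^ (-1 / 2 : ℝ)) < ∞ := by
  have h := hK.hasFiniteIntegral
  unfold HasFiniteIntegral at h
  refine lt_of_le_of_lt (le_of_eq ?_) h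
  congr 1 with u
  rw [enorm_mul]
  congr 1
  rw [← ofReal_norm, Complex.norm_real, Real.norm_of_nonneg (by positivity)]

/-- The `L¹` norm `∫ |K(u)| |u|^{-1/2} du`. -/
noncomputable def hausdorffBound (K : ℝ → ℂ) : ℝ :=
  (∫⁻ u, ‖K u‖ₑ * ENNReal.ofReal (|u| ^ (-1 / 2 : ℝ))).toReal

lemma lintegral_hausdorff_L2 {K : ℝ → ℂ} (hK : IsHausdorffKernel K) (f : L2R) :
    ∫⁻ x, (∫⁻ u, ‖K u‖ₑ * ‖f (u * x)‖ₑ) ^ 2 ≤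
      (ENNReal.ofReal (hausdorffBound K) * eLpNorm f 2 volume) ^ 2 := by
  have hf : Measurable (fun x => ‖f x‖ₑ) := (Lp.stronglyMeasurable f).measurable.enorm
  have h := lintegral_hausdorff_sq_le (fun u => ‖K u‖ₑ) (fun x => ‖f x‖ₑ)
    hK.aestronglyMeasurable.enorm hf
  have h2 : eLpNorm f 2 volume ^ 2 = ∫⁻ x, ‖f x‖ₑ ^ 2 := by
    have := eLpNorm_nnreal_pow_eq_lintegral (f := f) (μ := volume) (p := 2) (by norm_num)
    simpa using this
  rw [mul_pow, h2, hausdorffBound, ENNReal.ofReal_toReal (hausdorff_lintegral_lt_top hK).ne]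
  exact h

/-- For `f ∈ L²(ℝ)` the integral `∫ K(u) f(ux) du` converges absolutely for a.e. `x`. -/
lemma ae_integrable_hausdorff {K : ℝ → ℂ} (hK : IsHausdorffKernel K) (f : L2R) :
    ∀ᵐ x : ℝ, Integrable (fun u : ℝ => K u * f (u * x)) := by
  have hfm : Measurable f := (Lp.stronglyMeasurable f).measurable
  have hlt : ∫⁻ x, (∫⁻ u, ‖K u‖ₑ * ‖f (u * x)‖ₑ) ^ 2 < ∞ := by
    refine lt_of_le_of_lt (lintegral_hausdorff_L2 hK f) ?_
    have := Lp.eLpNorm_lt_top f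
    exact ENNReal.pow_lt_top (ENNReal.mul_lt_top ENNReal.ofReal_lt_top this)
  have hmeas : AEMeasurable (fun x => (∫⁻ u, ‖K u‖ₑ * ‖f (u * x)‖ₑ) ^ 2) volume := by
    apply AEMeasurable.pow_const
    apply AEMeasurable.lintegral_prod_right' (f := fun p : ℝ × ℝ => ‖K p.2‖ₑ * ‖f (p.2 * p.1)‖ₑ)
    have := hK.aestronglyMeasurable.enorm.comp_snd (μ := (volume : Measure ℝ))
    fun_prop
  filter_upwards [ae_lt_top' hmeas hlt.ne] with x hx
  refine ⟨hK.aestronglyMeasurable.mul (by fun_prop : Measurable _).aestronglyMeasurable, ?_⟩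
  unfold HasFiniteIntegral
  simp only [enorm_mul]
  by_contra hcon
  rw [not_lt, top_le_iff] at hcon
  rw [hcon] at hx
  simp at hx

lemma aestronglyMeasurable_hausdorffFun {K : ℝ → ℂ} (hK : IsHausdorffKernel K) (f : L2R) :
    AEStronglyMeasurable (hausdorffFun K f) volume := by
  have hfm : Measurable f := (Lp.stronglyMeasurable f).measurable
  apply AEStronglyMeasurable.integral_prod_right' (f := fun p : ℝ × ℝ => K p.2 * f (p.2 * p.1))
  exact (hK.aestronglyMeasurable.comp_snd (μ := (volume : Measure ℝ))).mul
    (by fun_prop : Measurable fun p : ℝ × ℝ => f (p.2 * p.1)).aestronglyMeasurable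

lemma eLpNorm_hausdorffFun_le {K : ℝ → ℂ} (hK : IsHausdorffKernel K) (f : L2R) :
    eLpNorm (hausdorffFun K f) 2 volume ≤
      ENNReal.ofReal (hausdorffBound K) * eLpNorm f 2 volume := by
  have h2 : eLpNorm (hausdorffFun K f) 2 volume ^ 2 = ∫⁻ x, ‖hausdorffFun K f x‖ₑ ^ 2 := by
    have := eLpNorm_nnreal_pow_eq_lintegral (f := hausdorffFun K f) (μ := volume) (p := 2)
      (by norm_num)
    simpa using this
  have h3 : eLpNorm (hausdorffFun K f) 2 volume ^ 2 ≤
      (ENNReal.ofReal (hausdorffBound K) * eLpNorm f 2 volume) ^ 2 := by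
    rw [h2]
    refine le_trans (lintegral_mono fun x => ?_) (lintegral_hausdorff_L2 hK f)
    refine pow_le_pow_left' ?_ 2
    refine (enorm_integral_le_lintegral_enorm _).trans (le_of_eq ?_)
    simp only [enorm_mul]
  exact (ENNReal.pow_le_pow_left_iff (by norm_num : (2 : ℕ) ≠ 0)).mp h3

lemma memLp_hausdorffFun {K : ℝ → ℂ} (hK : IsHausdorffKernel K) (f : L2R) :
    MemLp (hausdorffFun K f) 2 volume :=
  ⟨aestronglyMeasurable_hausdorffFun hK f, lt_of_le_of_lt (eLpNorm_hausdorffFun_le hK f)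
    (ENNReal.mul_lt_top ENNReal.ofReal_lt_top (Lp.eLpNorm_lt_top f))⟩

/-- The Hausdorff operator `𝓗_K`, `(𝓗_K f)(x) = ∫_ℝ K(u) f(ux) du`, as a bounded operator on
`L²(ℝ)`, for a kernel with `K(u)|u|^{-1/2} ∈ L¹(ℝ)`. -/
noncomputable def hausdorff (K : ℝ → ℂ) (hK : IsHausdorffKernel K) : L2R →L[ℂ] L2R :=
  LinearMap.mkContinuous
    { toFun := fun f => (memLp_hausdorffFun hK f).toLp (hausdorffFun K f)
      map_add' := by
        intro f g
        rw [← MemLp.toLp_add]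
        apply MemLp.toLp_congr
        refine (hausdorffFun_congr K (Lp.coeFn_add f g)).trans ?_
        filter_upwards [ae_integrable_hausdorff hK f, ae_integrable_hausdorff hK g] with x hf hg
        simp only [hausdorffFun, Pi.add_apply, mul_add]
        exact integral_add hf hg
      map_smul' := by
        intro c f
        rw [RingHom.id_apply, ← MemLp.toLp_const_smul]
        apply MemLp.toLp_congr
        refine (hausdorffFun_congr K (Lp.coeFn_smul c f)).trans ?_
        filter_upwards with x
        simp only [hausdorffFun, Pi.smul_apply, smul_eq_mul]
        rw [← integral_const_mul]
        congr 1 with u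
        ring }
    (hausdorffBound K)
    (by
      intro f
      simp only [LinearMap.coe_mk, AddHom.coe_mk]
      rw [Lp.norm_toLp, Lp.norm_def]
      have h := ENNReal.toReal_mono
        (ENNReal.mul_lt_top ENNReal.ofReal_lt_top (Lp.eLpNorm_lt_top f)).ne
        (eLpNorm_hausdorffFun_le hK f)
      rwa [ENNReal.toReal_mul, ENNReal.toReal_ofReal
        (show 0 ≤ hausdorffBound K from ENNReal.toReal_nonneg)] at h)

lemma hausdorff_ae (K : ℝ → ℂ) (hK : IsHausdorffKernel K) (f : L2R) :
    ∀ᵐ x : ℝ, hausdorff K hK f x = ∫ u : ℝ, K u * f (u * x) :=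
  (memLp_hausdorffFun hK f).coeFn_toLp

/-! ### Restriction to `L²(ℝ₊)` -/

/-- `L²(ℝ₊)` as the subspace of `L²(ℝ)` of functions vanishing a.e. on `(-∞, 0)`. -/
def L2Rplus : Submodule ℂ L2R where
  carrier := {f | ∀ᵐ x : ℝ, x < 0 → f x = 0}
  zero_mem' := by
    filter_upwards [Lp.coeFn_zero ℂ 2 (volume : Measure ℝ)] with x hx _
    simp
  add_mem' := by
    intro f g hf hg
    change ∀ᵐ x : ℝ, x < 0 → (f + g : L2R) x = 0
    have hf : ∀ᵐ x : ℝ, x < 0 → f x = 0 := hf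
    have hg : ∀ᵐ x : ℝ, x < 0 → g x = 0 := hg
    filter_upwards [Lp.coeFn_add f g, hf, hg] with x hx h1 h2 h
    rw [hx, Pi.add_apply, h1 h, h2 h, add_zero]
  smul_mem' := by
    intro c f hf
    change ∀ᵐ x : ℝ, x < 0 → (c • f : L2R) x = 0
    have hf : ∀ᵐ x : ℝ, x < 0 → f x = 0 := hf
    filter_upwards [Lp.coeFn_smul c f, hf] with x hx h1 h
    rw [hx, Pi.smul_apply, h1 h, smul_zero]

lemma isClosed_L2Rplus : IsClosed (L2Rplus : Set L2R) := by
  let T := LpToLpRestrictCLM ℝ ℂ ℂ (volume : Measure ℝ) 2 (Iio (0 : ℝ))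
  have h : (L2Rplus : Set L2R) = T ⁻¹' {0} := by
    ext f
    have h1 : f ∈ (L2Rplus : Set L2R) ↔ ∀ᵐ x ∂volume.restrict (Iio (0 : ℝ)), f x = 0 := by
      rw [ae_restrict_iff' measurableSet_Iio]
      rfl
    rw [h1, mem_preimage, mem_singleton_iff, Lp.eq_zero_iff_ae_eq_zero]
    have h2 := LpToLpRestrictCLM_coeFn (μ := (volume : Measure ℝ)) (p := 2) ℂ (Iio (0 : ℝ)) f
    constructor
    · intro h
      filter_upwards [h, h2] with x hx hx2
      exact hx2.trans hx
    · intro h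
      filter_upwards [h, h2] with x hx hx2
      exact hx2.symm.trans hx
  rw [h]
  exact isClosed_singleton.preimage T.continuous

instance : CompleteSpace L2Rplus := isClosed_L2Rplus.completeSpace_coe

/-- The restriction `A₊` of a bounded operator `A` on `L²(ℝ)` that leaves `L²(ℝ₊)` invariant,
as a bounded operator on `L²(ℝ₊)`. -/
noncomputable def restrictPlus (A : L2R →L[ℂ] L2R) (hA : ∀ f ∈ L2Rplus, A f ∈ L2Rplus) :
    L2Rplus →L[ℂ] L2Rplus :=
  (A.comp L2Rplus.subtypeL).codRestrict L2Rplus (fun f => hA f f.2)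

/-- Condition (a): `K(u) = 0` for a.e. `u < 0`. -/
def KernelCondA (K : ℝ → ℂ) : Prop :=
  ∀ᵐ u : ℝ, u < 0 → K u = 0

/-- Condition (b): `K(u) u^{-1/2} ∈ L¹(ℝ₊)`. -/
def KernelCondB (K : ℝ → ℂ) : Prop :=
  IntegrableOn (fun u : ℝ => K u * ((u ^ (-1 / 2 : ℝ) : ℝ) : ℂ)) (Ioi 0)

/-- Condition (c): `(ℳK)(z) = F(z⁻¹)` on the critical line `Re z = 1/2`. -/
def KernelCondC (F : ℂ → ℂ) (K : ℝ → ℂ) : Prop :=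
  ∀ z : ℂ, z.re = 1 / 2 → mellin K z = F z⁻¹

lemma KernelCondA.isHausdorffKernel {K : ℝ → ℂ} (ha : KernelCondA K) (hb : KernelCondB K) :
    IsHausdorffKernel K := by
  have hb' : Integrable
      ((Ioi (0 : ℝ)).indicator fun u : ℝ => K u * ((u ^ (-1 / 2 : ℝ) : ℝ) : ℂ)) :=
    (integrable_indicator_iff measurableSet_Ioi).mpr hb
  refine hb'.congr ?_
  filter_upwards [ha, ae_ne_zero_real] with u hu hu0
  rcases lt_or_gt_of_ne hu0 with h | h
  · simp [hu h]
  · simp [indicator_of_mem (show u ∈ Ioi (0 : ℝ) from h), abs_of_pos h]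

/-- If `K` is supported in `ℝ₊`, then `L²(ℝ₊)` is invariant under `𝓗_K`. -/
lemma hausdorff_mem_L2Rplus {K : ℝ → ℂ} (ha : KernelCondA K) (hK : IsHausdorffKernel K)
    (f : L2R) (hf : f ∈ L2Rplus) : hausdorff K hK f ∈ L2Rplus := by
  change ∀ᵐ x : ℝ, x < 0 → hausdorff K hK f x = 0
  have hf' : ∀ᵐ x : ℝ, x < 0 → f x = 0 := hf
  filter_upwards [hausdorff_ae K hK f] with x hx hneg
  rw [hx]
  apply integral_eq_zero_of_ae
  have hq : Measure.QuasiMeasurePreserving (fun u : ℝ => u * x) volume volume := by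
    refine ⟨by fun_prop, ?_⟩
    rw [Real.map_volume_mul_right hneg.ne]
    exact Measure.smul_absolutelyContinuous
  filter_upwards [ha, hq.ae hf', ae_ne_zero_real] with u hu hfu hu0
  rcases lt_or_gt_of_ne hu0 with h | h
  · simp [hu h]
  · simp [hfu (mul_neg_of_pos_of_neg h hneg)]

/-- The operator `(𝓗_K)₊` on `L²(ℝ₊)`, for a kernel `K` satisfying (a) and (b). -/
noncomputable def hausdorffPlus (K : ℝ → ℂ) (ha : KernelCondA K) (hb : KernelCondB K) :
    L2Rplus →L[ℂ] L2Rplus :=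
  restrictPlus (hausdorff K (ha.isHausdorffKernel hb))
    (hausdorff_mem_L2Rplus ha (ha.isHausdorffKernel hb))

/-! ### The Cesàro operator -/

/-- The kernel `χ_{(0,1)}` of the Cesàro operator `f ↦ (1/x) ∫₀ˣ f(t) dt = ∫₀¹ f(ux) du`. -/
noncomputable def cesaroKernel : ℝ → ℂ := (Ioo (0 : ℝ) 1).indicator 1

lemma cesaroKernel_condA : KernelCondA cesaroKernel := by
  filter_upwards with u hu
  exact indicator_of_notMem (fun h => (lt_asymm hu h.1).elim) _

lemma cesaroKernel_condB : KernelCondB cesaroKernel := by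
  have h : IntegrableOn (fun u : ℝ => ((u ^ (-1 / 2 : ℝ) : ℝ) : ℂ)) (Ioo 0 1) :=
    ((intervalIntegral.integrableOn_Ioo_rpow_iff (by norm_num)).mpr (by norm_num)).ofReal
  refine (((integrable_indicator_iff measurableSet_Ioo).mpr h).congr ?_).integrableOn
  filter_upwards with u
  by_cases hu : u ∈ Ioo (0 : ℝ) 1 <;> simp [cesaroKernel, hu]

/-- The Cesàro operator `𝒞` on `L²(ℝ)`. -/
noncomputable def cesaro : L2R →L[ℂ] L2R :=
  hausdorff cesaroKernel (cesaroKernel_condA.isHausdorffKernel cesaroKernel_condB)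

/-- The Cesàro operator is given by `(𝒞f)(x) = (1/x) ∫₀ˣ f(t) dt`. -/
lemma cesaro_ae (f : L2R) :
    ∀ᵐ x : ℝ, cesaro f x = (1 / (x : ℂ)) * ∫ t in (0 : ℝ)..x, f t := by
  filter_upwards [hausdorff_ae cesaroKernel
    (cesaroKernel_condA.isHausdorffKernel cesaroKernel_condB) f, ae_ne_zero_real] with x hx hx0
  have h1 : (fun u : ℝ => cesaroKernel u * f (u * x)) =
      (Ioo (0 : ℝ) 1).indicator fun u => f (u * x) := by
    funext u
    by_cases hu : u ∈ Ioo (0 : ℝ) 1 <;> simp [cesaroKernel, hu]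
  have h2 := intervalIntegral.integral_comp_mul_right (a := 0) (b := 1) (f := fun t => f t) hx0
  rw [cesaro, hx, h1, integral_indicator measurableSet_Ioo, ← integral_Ioc_eq_integral_Ioo,
    ← intervalIntegral.integral_of_le zero_le_one, h2]
  simp [Complex.real_smul]

/-- The Cesàro operator `𝒞₊` on `L²(ℝ₊)`, the restriction of `𝒞`. -/
noncomputable def cesaroPlus : L2Rplus →L[ℂ] L2Rplus :=
  restrictPlus cesaro (hausdorff_mem_L2Rplus cesaroKernel_condA _)

/-! ### Holomorphic functional calculus on annuli around the circle `𝕋 + 1` -/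

/-- The closed annulus `{r ≤ |λ - 1| ≤ R}` is a neighbourhood of the circle `𝕋 + 1` that does not
contain its centre, and it lies in `N`. -/
def IsAdmissibleAnnulus (N : Set ℂ) (r R : ℝ) : Prop :=
  0 < r ∧ r < 1 ∧ 1 < R ∧ ∀ w : ℂ, r ≤ ‖w - 1‖ → ‖w - 1‖ ≤ R → w ∈ N

/-- Every open neighbourhood of the circle `𝕋 + 1` contains an admissible annulus. -/
lemma exists_isAdmissibleAnnulus {N : Set ℂ} (hN : IsOpen N)
    (hsub : Metric.sphere (1 : ℂ) 1 ⊆ N) : ∃ r R : ℝ, IsAdmissibleAnnulus N r R := by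
  obtain ⟨δ, hδ, h⟩ := (isCompact_sphere (1 : ℂ) 1).exists_cthickening_subset_open hN hsub
  have hm : 0 < min δ (1 / 2) := lt_min hδ (by norm_num)
  have hm2 : min δ (1 / 2) ≤ 1 / 2 := min_le_right _ _
  have hm1 : min δ (1 / 2) ≤ δ := min_le_left _ _
  refine ⟨1 - min δ (1 / 2), 1 + min δ (1 / 2), by linarith, by linarith, by linarith, ?_⟩
  intro w h1 h2
  apply h
  have hpos : 0 < ‖w - 1‖ := by linarith
  have hne : (‖w - 1‖ : ℂ) ≠ 0 := by exact_mod_cast hpos.ne'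
  refine Metric.mem_cthickening_of_dist_le w (1 + (w - 1) / ‖w - 1‖) δ _ ?_ ?_
  · simp [hpos.ne']
  · have e : w - (1 + (w - 1) / ‖w - 1‖) = ((1 - ‖w - 1‖⁻¹ : ℝ) : ℂ) * (w - 1) := by
      push_cast
      field_simp
      ring
    have e2 : (1 - ‖w - 1‖⁻¹) * ‖w - 1‖ = ‖w - 1‖ - 1 := by field_simp
    rw [dist_eq_norm, e, norm_mul, Complex.norm_real, Real.norm_eq_abs]
    calc |1 - ‖w - 1‖⁻¹| * ‖w - 1‖ = |(1 - ‖w - 1‖⁻¹) * ‖w - 1‖| := by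
          rw [abs_mul, abs_of_pos hpos]
      _ ≤ δ := by rw [e2, abs_le]; constructor <;> linarith

/-- The Riesz–Dunford integral `F(T) = (1/2πi) ∫_Γ F(λ) (λI - T)⁻¹ dλ`, where `Γ` is the positively
oriented boundary of the annulus `{r < |λ - 1| < R}`. -/
noncomputable def annulusCalculus (F : ℂ → ℂ) (r R : ℝ) (T : L2Rplus →L[ℂ] L2Rplus) :
    L2Rplus →L[ℂ] L2Rplus :=
  (2 * (Real.pi : ℂ) * Complex.I)⁻¹ •
    ((∮ w in C(1, R), F w • resolvent T w) - ∮ w in C(1, r), F w • resolvent T w)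

/-! The substitution u = e^{-t} turns the Mellin transform on Re z = 1/2 into a Fourier transform
and condition (b) into integrability. On this line the Mellin transform is therefore injective
(`KernelCondB.ae_eq_of_mellin_eq`) and tends to 0 at infinity. Hausdorff operators commute with
dilations, so composing them convolves their kernels multiplicatively and multiplies their Mellin
transforms. Hence an algebraic identity between transforms is an identity between operators
(`inner_hausdorffPlus_comp`).

The Cesàro kernel has transform 1/z, and w ↦ 1/w carries 𝕋 + 1 without 0 onto the critical line.
Since (w - 1/z)⁻¹ = w⁻¹ + w⁻²(z - w⁻¹)⁻¹, the resolvent of 𝒞₊ at a point w off the circle is w⁻¹ +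
w⁻²𝓗_κ, where κ has transform (z - w⁻¹)⁻¹. Such a κ is u^{-1/w} on (0, 1] when w is outside the
circle, and -u^{-1/w} on (1, ∞) when w is inside (`isUnit_and_resolvent_cesaroPlus`).

Insert this in the Riesz–Dunford integral. By Cauchy's formula at the point 0 of the circle, the w⁻¹
terms give F(0)I. By Fubini, the other terms give a Hausdorff operator with kernel `annulusKernel`
(`IsAdmissibleAnnulus.inner_annulusCalculus`). Cauchy's formula at 1/z and at 0 shows that this
kernel has transform F(1/z) - F(0). If F(0) = 0 it is the required K, and injectivity identifies it
with every other K satisfying (a), (b) and (c). Conversely, letting z → ∞ in (c) gives F(0) = 0 by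
Riemann–Lebesgue. -/

/-! ### The Mellin transform on the critical line: uniqueness and decay -/

open scoped FourierTransform in
/-- An integrable function whose Fourier transform vanishes is zero almost everywhere. -/
lemma ae_eq_zero_of_fourier_eq_zero {k : ℝ → ℂ} (hk : Integrable k) (h : ∀ ξ, 𝓕 k ξ = 0) :
    ∀ᵐ x, k x = 0 := by
  apply ae_eq_zero_of_integral_contDiff_smul_eq_zero hk.locallyIntegrable
  intro g hg hgc
  have hgc' : HasCompactSupport (fun x => (g x : ℂ)) := hgc.comp_left (g := Complex.ofReal) rfl
  have hg' : ContDiff ℝ (⊤ : ℕ∞) (fun x => (g x : ℂ)) := Complex.ofRealCLM.contDiff.comp hg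
  let ψ : SchwartzMap ℝ ℂ := hgc'.toSchwartzMap hg'
  let φ : SchwartzMap ℝ ℂ := 𝓕⁻ ψ
  have h1 : 𝓕 φ = ψ := FourierTransform.fourier_fourierInv_eq ψ
  -- The test function is the Fourier transform of the Schwartz function `φ`. Moving the transform
  -- from `φ` onto `k` leaves an integral against 𝓕k = 0.
  have h2 := VectorFourier.integral_fourierIntegral_smul_eq_flip (μ := (volume : Measure ℝ))
    (ν := (volume : Measure ℝ)) (L := innerₗ ℝ) Real.continuous_fourierChar
    continuous_inner hk φ.integrable
  have h3 : ∀ x, VectorFourier.fourierIntegral Real.fourierChar volume (innerₗ ℝ).flip φ x = ψ x := by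
    intro x
    rw [← h1, SchwartzMap.fourier_coe, flip_innerₗ]
    rfl
  have h4 : ∀ x, VectorFourier.fourierIntegral Real.fourierChar volume (innerₗ ℝ) k x = 0 := h
  simp only [h3, h4, zero_smul, integral_zero] at h2
  rw [h2]
  apply integral_congr_ae
  filter_upwards with x
  change g x • k x = k x • (g x : ℂ)
  rw [Complex.real_smul, smul_eq_mul, mul_comm]

/-- The function `t ↦ e^{-t/2} K(e^{-t})`, whose Fourier transform is the Mellin transform of `K`
on the critical line. -/
noncomputable def logKernel (K : ℝ → ℂ) (t : ℝ) : ℂ :=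
  Real.exp (-(1 / 2) * t) • K (Real.exp (-t))

lemma exp_neg_image_univ : (fun t : ℝ => Real.exp (-t)) '' univ = Ioi 0 := by
  rw [show (fun t : ℝ => Real.exp (-t)) = Real.exp ∘ Neg.neg from rfl, image_comp,
    image_univ_of_surjective neg_surjective, image_univ, Real.range_exp]

lemma hasDerivWithinAt_exp_neg (x : ℝ) (_ : x ∈ (univ : Set ℝ)) :
    HasDerivWithinAt (fun t : ℝ => Real.exp (-t)) (-Real.exp (-x)) univ x := by
  have := ((hasDerivAt_neg x).exp).hasDerivWithinAt (s := univ)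
  simpa using this

lemma injOn_exp_neg : InjOn (fun t : ℝ => Real.exp (-t)) univ :=
  fun _ _ _ _ h => neg_injective (Real.exp_injective h)

/-- The Jacobian e^{-t} and the weight u^{-1/2} = e^{t/2} combine to e^{-t/2}, so u = e^{-t} turns
the weighted L¹ condition (b) into plain integrability of `logKernel K`. -/
lemma abs_exp_smul_kernel (K : ℝ → ℂ) (t : ℝ) :
    |(-Real.exp (-t))| • (K (Real.exp (-t)) * ((Real.exp (-t) ^ (-1 / 2 : ℝ) : ℝ) : ℂ)) =
      logKernel K t := by
  rw [abs_neg, abs_of_pos (Real.exp_pos _), ← Real.exp_mul, logKernel]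
  simp only [Complex.real_smul]
  rw [mul_comm (K _), ← mul_assoc, ← Complex.ofReal_mul, ← Real.exp_add]
  congr 3
  ring

lemma KernelCondB.integrable_logKernel {K : ℝ → ℂ} (hb : KernelCondB K) :
    Integrable (logKernel K) := by
  have h := hb
  unfold KernelCondB at h
  rw [← exp_neg_image_univ, integrableOn_image_iff_integrableOn_abs_deriv_smul MeasurableSet.univ
    hasDerivWithinAt_exp_neg injOn_exp_neg, integrableOn_univ] at h
  exact h.congr (.of_forall fun t => abs_exp_smul_kernel K t)

lemma mellin_eq_fourier_logKernel (K : ℝ → ℂ) {z : ℂ} (hz : z.re = 1 / 2) :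
    mellin K z = FourierTransform.fourier (logKernel K) (z.im / (2 * Real.pi)) := by
  rw [mellin_eq_fourier, hz]
  rfl

/-- The Mellin transform on the critical line is injective. -/
lemma KernelCondB.ae_eq_zero_of_mellin {K : ℝ → ℂ} (hb : KernelCondB K)
    (h : ∀ z : ℂ, z.re = 1 / 2 → mellin K z = 0) : ∀ᵐ u, u ∈ Ioi (0 : ℝ) → K u = 0 := by
  have h1 : ∀ᵐ t, logKernel K t = 0 := by
    apply ae_eq_zero_of_fourier_eq_zero hb.integrable_logKernel
    intro ξ
    -- The Fourier character is e^{-2πitξ}, so the frequency ξ corresponds to z = 1/2 + 2πiξ.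
    have h2 := h ⟨1 / 2, 2 * Real.pi * ξ⟩ rfl
    rw [mellin_eq_fourier_logKernel K rfl] at h2
    convert h2 using 2
    have := Real.pi_ne_zero
    field_simp
  -- Vanishing a.e. is carried back to the variable u through the weighted L¹ norm, which the
  -- substitution preserves.
  have h3 : ∫ u in Ioi (0 : ℝ), ‖K u * ((u ^ (-1 / 2 : ℝ) : ℝ) : ℂ)‖ = 0 := by
    rw [← exp_neg_image_univ, integral_image_eq_integral_abs_deriv_smul MeasurableSet.univ
      hasDerivWithinAt_exp_neg injOn_exp_neg, setIntegral_univ]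
    apply integral_eq_zero_of_ae
    filter_upwards [h1] with t ht
    have h4 := abs_exp_smul_kernel K t
    rw [ht] at h4
    have h5 := congrArg norm h4
    rw [norm_smul, norm_zero, Real.norm_eq_abs, abs_abs] at h5
    exact h5
  rw [integral_eq_zero_iff_of_nonneg (fun _ => norm_nonneg _) (Integrable.norm hb)] at h3
  have h4 := (ae_restrict_iff' measurableSet_Ioi).mp h3
  filter_upwards [h4] with u hu hu0
  have h5 : K u * ((u ^ (-1 / 2 : ℝ) : ℝ) : ℂ) = 0 := norm_eq_zero.mp (hu hu0)
  have h6 : ((u ^ (-1 / 2 : ℝ) : ℝ) : ℂ) ≠ 0 := by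
    exact_mod_cast (Real.rpow_pos_of_pos hu0 _).ne'
  exact (mul_eq_zero.mp h5).resolve_right h6

/-- Riemann–Lebesgue lemma for the Mellin transform on the critical line. -/
lemma tendsto_mellin_critical_line (K : ℝ → ℂ) :
    Filter.Tendsto (fun t : ℝ => mellin K (1 / 2 + t * Complex.I)) Filter.atTop (nhds 0) := by
  have h1 : ∀ t : ℝ, mellin K (1 / 2 + t * Complex.I) =
      FourierTransform.fourier (logKernel K) (t / (2 * Real.pi)) := by
    intro t
    rw [mellin_eq_fourier_logKernel K (by simp)]
    simp
  simp only [h1]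
  -- Integrability is not needed: a non-integrable function has Fourier integral 0 by convention.
  refine (Real.zero_at_infty_fourier (logKernel K)).comp ?_
  refine Filter.Tendsto.mono_right ?_ atTop_le_cocompact
  exact Filter.tendsto_id.atTop_div_const (by positivity)

/-! ### Test functions of size u^{-1/2} and multiplicative convolution -/

/-- A measurable function on `ℝ₊` bounded by a multiple of `u^{-1/2}`. -/
def IsHalfBounded (φ : ℝ → ℂ) : Prop :=
  Measurable φ ∧ ∃ B : ℝ, ∀ u, 0 < u → ‖φ u‖ ≤ B * u ^ (-1 / 2 : ℝ)

/-- Three kinds of test function are used: u^{z-1} yields Mellin transforms, u^{-1/2} yields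
condition (b), and the matrix coefficients of dilations yield operators. One Fubini theorem for this
class serves all three. -/
lemma isHalfBounded_cpow {z : ℂ} (hz : z.re = 1 / 2) :
    IsHalfBounded (fun u : ℝ => (u : ℂ) ^ (z - 1)) := by
  refine ⟨by fun_prop, 1, fun u hu => ?_⟩
  rw [Complex.norm_cpow_eq_rpow_re_of_pos hu, one_mul, Complex.sub_re, hz]
  norm_num

lemma isHalfBounded_rpow : IsHalfBounded (fun u : ℝ => ((u ^ (-1 / 2 : ℝ) : ℝ) : ℂ)) := by
  refine ⟨by fun_prop, 1, fun u hu => ?_⟩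
  rw [Complex.norm_real, one_mul, Real.norm_of_nonneg (by positivity)]

lemma KernelCondB.integrableOn_mul {K φ : ℝ → ℂ} (hb : KernelCondB K) (hφ : IsHalfBounded φ) :
    IntegrableOn (fun u => K u * φ u) (Ioi 0) := by
  obtain ⟨hm, B, hB⟩ := hφ
  have hm2 : Measurable (fun u : ℝ => φ u * ((u ^ (1 / 2 : ℝ) : ℝ) : ℂ)) := by fun_prop
  have h := Integrable.mul_bdd (c := B) hb hm2.aestronglyMeasurable (by
    filter_upwards [ae_restrict_mem measurableSet_Ioi] with u hu
    rw [norm_mul, Complex.norm_real, Real.norm_of_nonneg (Real.rpow_nonneg (le_of_lt hu) _)]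
    calc ‖φ u‖ * u ^ (1 / 2 : ℝ) ≤ B * u ^ (-1 / 2 : ℝ) * u ^ (1 / 2 : ℝ) :=
          mul_le_mul_of_nonneg_right (hB u hu) (Real.rpow_nonneg (le_of_lt hu) _)
      _ = B := by
          rw [mul_assoc, ← Real.rpow_add hu]
          norm_num)
  refine h.congr ?_
  filter_upwards [ae_restrict_mem measurableSet_Ioi] with u hu
  have : ((u ^ (-1 / 2 : ℝ) : ℝ) : ℂ) * ((u ^ (1 / 2 : ℝ) : ℝ) : ℂ) = 1 := by
    rw [← Complex.ofReal_mul, ← Real.rpow_add hu]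
    norm_num
  calc _ = K u * φ u * (((u ^ (-1 / 2 : ℝ) : ℝ) : ℂ) * ((u ^ (1 / 2 : ℝ) : ℝ) : ℂ)) := by ring
    _ = _ := by rw [this, mul_one]

/-- Multiplicative convolution on `ℝ₊`. -/
noncomputable def mulConv (K L : ℝ → ℂ) (w : ℝ) : ℂ :=
  ∫ u in Ioi (0 : ℝ), K u * L (w / u) * (u : ℂ)⁻¹

section mulConv

variable {K L φ : ℝ → ℂ}

/-- The weight u^{-1/2} is multiplicative, so the bound on φ(uv) splits between the two factors.
What remains is a product of two integrable functions times a bounded one. -/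
lemma integrable_prod_kernel (hbK : KernelCondB K) (hbL : KernelCondB L)
    (hφ : IsHalfBounded φ) :
    Integrable (fun p : ℝ × ℝ => K p.1 * (L p.2 * φ (p.1 * p.2)))
      ((volume.restrict (Ioi 0)).prod (volume.restrict (Ioi 0))) := by
  obtain ⟨hm, B, hB⟩ := hφ
  have h0 : ∀ᵐ p : ℝ × ℝ ∂((volume.restrict (Ioi 0)).prod (volume.restrict (Ioi 0))),
      0 < p.1 ∧ 0 < p.2 := by
    rw [Measure.prod_restrict]
    filter_upwards [ae_restrict_mem (measurableSet_Ioi.prod measurableSet_Ioi)] with p hp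
    exact hp
  have hm2 : Measurable (fun p : ℝ × ℝ => φ (p.1 * p.2) *
      (((p.1 * p.2) ^ (1 / 2 : ℝ) : ℝ) : ℂ)) := by fun_prop
  have h := Integrable.mul_bdd (c := B) (Integrable.mul_prod hbK hbL) hm2.aestronglyMeasurable (by
    filter_upwards [h0] with p hp
    have hp' := mul_pos hp.1 hp.2
    rw [norm_mul, Complex.norm_real, Real.norm_of_nonneg (Real.rpow_nonneg hp'.le _)]
    calc ‖φ (p.1 * p.2)‖ * (p.1 * p.2) ^ (1 / 2 : ℝ)
        ≤ B * (p.1 * p.2) ^ (-1 / 2 : ℝ) * (p.1 * p.2) ^ (1 / 2 : ℝ) :=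
          mul_le_mul_of_nonneg_right (hB _ hp') (Real.rpow_nonneg hp'.le _)
      _ = B := by
          rw [mul_assoc, ← Real.rpow_add hp']
          norm_num)
  refine h.congr ?_
  filter_upwards [h0] with p hp
  have : ((p.1 ^ (-1 / 2 : ℝ) : ℝ) : ℂ) * ((p.2 ^ (-1 / 2 : ℝ) : ℝ) : ℂ) *
      (((p.1 * p.2) ^ (1 / 2 : ℝ) : ℝ) : ℂ) = 1 := by
    rw [← Complex.ofReal_mul, ← Complex.ofReal_mul, ← Real.mul_rpow hp.1.le hp.2.le,
      ← Real.rpow_add (mul_pos hp.1 hp.2)]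
    norm_num
  calc _ = K p.1 * (L p.2 * φ (p.1 * p.2)) * (((p.1 ^ (-1 / 2 : ℝ) : ℝ) : ℂ) *
      ((p.2 ^ (-1 / 2 : ℝ) : ℝ) : ℂ) * (((p.1 * p.2) ^ (1 / 2 : ℝ) : ℝ) : ℂ)) := by ring
    _ = _ := by rw [this, mul_one]

lemma integral_Ioi_comp_div (g : ℝ → ℂ) {u : ℝ} (hu : 0 < u) :
    ∫ w in Ioi (0 : ℝ), g (w / u) * (u : ℂ)⁻¹ = ∫ v in Ioi (0 : ℝ), g v := by
  have h := integral_comp_mul_left_Ioi (fun w => g (w / u) * (u : ℂ)⁻¹) 0 hu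
  rw [mul_zero] at h
  have hu' : (u : ℂ) ≠ 0 := by exact_mod_cast hu.ne'
  rw [eq_inv_smul_iff₀ hu.ne'] at h
  rw [← h, ← integral_smul]
  congr 1 with v
  rw [mul_div_cancel_left₀ _ hu.ne', Complex.real_smul]
  field_simp

/-- For fixed u, the substitution w = uv reduces this to `integrable_prod_kernel`. Measurability of
K and L makes K(u)L(w/u) jointly measurable. -/
lemma integrable_mulConv_kernel (hK : Measurable K) (hL : Measurable L)
    (hbK : KernelCondB K) (hbL : KernelCondB L) (hφ : IsHalfBounded φ) :
    Integrable (fun p : ℝ × ℝ => K p.1 * L (p.2 / p.1) * (p.1 : ℂ)⁻¹ * φ p.2)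
      ((volume.restrict (Ioi 0)).prod (volume.restrict (Ioi 0))) := by
  have hint := integrable_prod_kernel hbK hbL hφ
  have hφm := hφ.1
  have hmeas : Measurable (fun p : ℝ × ℝ => K p.1 * L (p.2 / p.1) * (p.1 : ℂ)⁻¹ * φ p.2) := by
    fun_prop
  rw [integrable_prod_iff hmeas.aestronglyMeasurable]
  constructor
  · filter_upwards [hint.prod_right_ae, ae_restrict_mem measurableSet_Ioi] with u hu hu0
    have hu0 : 0 < u := hu0
    have h := (integrableOn_Ioi_comp_mul_left_iff
      (fun w => K u * L (w / u) * (u : ℂ)⁻¹ * φ w) 0 hu0)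
    rw [mul_zero] at h
    refine h.mp ?_
    refine (Integrable.mul_const hu (u : ℂ)⁻¹).congr (.of_forall fun v => ?_)
    simp only [mul_div_cancel_left₀ _ hu0.ne']
    ring
  · refine hint.integral_norm_prod_left.congr ?_
    filter_upwards [ae_restrict_mem measurableSet_Ioi] with u hu
    have hu0 : 0 < u := hu
    have h := integral_comp_mul_left_Ioi
      (fun w => ‖K u * L (w / u) * (u : ℂ)⁻¹ * φ w‖) 0 hu0
    rw [mul_zero, eq_inv_smul_iff₀ hu0.ne', ← integral_smul] at h
    rw [← h]
    congr 1 with v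
    rw [mul_div_cancel_left₀ _ hu0.ne']
    simp only [norm_mul, norm_inv, Complex.norm_real, Real.norm_of_nonneg hu0.le, smul_eq_mul]
    field_simp

/-- Fubini's theorem for the multiplicative convolution. -/
lemma integral_mulConv_mul (hK : Measurable K) (hL : Measurable L)
    (hbK : KernelCondB K) (hbL : KernelCondB L) (hφ : IsHalfBounded φ) :
    ∫ w in Ioi (0 : ℝ), mulConv K L w * φ w =
      ∫ u in Ioi (0 : ℝ), K u * ∫ v in Ioi (0 : ℝ), L v * φ (u * v) := by
  have hint := integrable_mulConv_kernel hK hL hbK hbL hφ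
  simp only [mulConv, ← integral_mul_const]
  rw [← integral_integral_swap (f := fun u w => K u * L (w / u) * (u : ℂ)⁻¹ * φ w) hint]
  apply setIntegral_congr_fun measurableSet_Ioi
  intro u hu
  have hu0 : 0 < u := hu
  simp only
  rw [← integral_Ioi_comp_div (fun v => L v * φ (u * v)) hu0, ← integral_const_mul]
  congr 1 with w
  rw [mul_div_cancel₀ _ hu0.ne']
  ring

lemma kernelCondB_mulConv (hK : Measurable K) (hL : Measurable L)
    (hbK : KernelCondB K) (hbL : KernelCondB L) : KernelCondB (mulConv K L) := by
  have h := (integrable_mulConv_kernel hK hL hbK hbL isHalfBounded_rpow).integral_prod_right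
  refine h.congr (.of_forall fun w => ?_)
  simp only [mulConv, ← integral_mul_const]

/-- In Fubini's theorem take φ(u) = u^{z-1}: it is multiplicative, so the double integral factors.
-/
lemma mellin_mulConv (hK : Measurable K) (hL : Measurable L)
    (hbK : KernelCondB K) (hbL : KernelCondB L) {z : ℂ} (hz : z.re = 1 / 2) :
    mellin (mulConv K L) z = mellin K z * mellin L z := by
  have h := integral_mulConv_mul hK hL hbK hbL (isHalfBounded_cpow hz)
  have e : ∀ J : ℝ → ℂ, mellin J z = ∫ u in Ioi (0 : ℝ), J u * (u : ℂ) ^ (z - 1) := by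
    intro J
    simp only [mellin, smul_eq_mul, mul_comm]
  rw [e, h, e K, ← integral_mul_const]
  apply setIntegral_congr_fun measurableSet_Ioi
  intro u hu
  have hu0 : 0 < u := hu
  simp only
  rw [e L, mul_assoc]
  congr 1
  rw [← integral_const_mul]
  apply setIntegral_congr_fun measurableSet_Ioi
  intro v hv
  simp only
  rw [Complex.ofReal_mul, Complex.mul_cpow_ofReal_nonneg hu0.le (le_of_lt hv)]
  ring

end mulConv

lemma KernelCondB.sub {K L : ℝ → ℂ} (hK : KernelCondB K) (hL : KernelCondB L) :
    KernelCondB (fun u => K u - L u) := by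
  refine (Integrable.sub hK hL).congr (.of_forall fun u => ?_)
  simp only [Pi.sub_apply]
  ring

lemma KernelCondB.const_mul {K : ℝ → ℂ} (hK : KernelCondB K) (c : ℂ) :
    KernelCondB (fun u => c * K u) := by
  refine (Integrable.const_mul hK c).congr (.of_forall fun u => ?_)
  simp only
  ring

lemma KernelCondB.mellinConvergent {K : ℝ → ℂ} (hK : KernelCondB K) {z : ℂ} (hz : z.re = 1 / 2) :
    MellinConvergent K z :=
  (hK.integrableOn_mul (isHalfBounded_cpow hz)).congr
    (.of_forall fun u => by simp only [smul_eq_mul, mul_comm])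

/-- Kernels with the same Mellin transform on the critical line agree on `ℝ₊`. -/
lemma KernelCondB.ae_eq_of_mellin_eq {K L : ℝ → ℂ} (hK : KernelCondB K) (hL : KernelCondB L)
    (h : ∀ z : ℂ, z.re = 1 / 2 → mellin K z = mellin L z) :
    K =ᵐ[volume.restrict (Ioi 0)] L := by
  have h1 := (hK.sub hL).ae_eq_zero_of_mellin (fun z hz => by
    have := hasMellin_sub (hK.mellinConvergent hz) (hL.mellinConvergent hz)
    rw [this.2, h z hz, sub_self])
  refine (ae_restrict_iff' measurableSet_Ioi).mpr ?_
  filter_upwards [h1] with u hu hu0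
  exact sub_eq_zero.mp (hu hu0)

/-! ### Matrix coefficients and composition of Hausdorff operators -/

/-- The matrix coefficient `u ↦ ∫ f(ux) conj(g(x)) dx` of the dilations. -/
noncomputable def dilationCoeff (g f : ℝ → ℂ) (u : ℝ) : ℂ :=
  ∫ x : ℝ, f (u * x) * (starRingEnd ℂ) (g x)

lemma quasiMeasurePreserving_mul_left {u : ℝ} (hu : u ≠ 0) :
    Measure.QuasiMeasurePreserving (fun x : ℝ => u * x) volume volume := by
  refine ⟨by fun_prop, ?_⟩
  rw [Real.map_volume_mul_left hu]
  exact Measure.smul_absolutelyContinuous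

lemma eLpNorm_two_sq (f : ℝ → ℂ) : eLpNorm f 2 volume ^ 2 = ∫⁻ x, ‖f x‖ₑ ^ 2 := by
  have := eLpNorm_nnreal_pow_eq_lintegral (f := f) (μ := volume) (p := 2) (by norm_num)
  simpa using this

lemma eLpNorm_comp_mul_left (f : L2R) {u : ℝ} (hu : 0 < u) :
    eLpNorm (fun x => f (u * x)) 2 volume =
      ENNReal.ofReal (u ^ (-1 / 2 : ℝ)) * eLpNorm f 2 volume := by
  have hf : Measurable (fun x => ‖f x‖ₑ) := (Lp.stronglyMeasurable f).measurable.enorm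
  have h := lintegral_sq_comp_mul (fun x => ‖f x‖ₑ) hf hu.ne'
  rw [← eLpNorm_two_sq, ← eLpNorm_two_sq] at h
  have h2 : (ENNReal.ofReal (u ^ (-1 / 2 : ℝ))) ^ 2 = ENNReal.ofReal |u⁻¹| := by
    rw [← ENNReal.ofReal_pow (by positivity), ← Real.rpow_natCast, ← Real.rpow_mul hu.le,
      abs_of_pos (inv_pos.mpr hu), ← Real.rpow_neg_one]
    norm_num
  rw [← h2, ← mul_pow] at h
  have h3 := fun {a b : ℝ≥0∞} => ENNReal.pow_le_pow_left_iff (a := a) (b := b)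
    (by norm_num : (2 : ℕ) ≠ 0)
  exact le_antisymm (h3.mp h.le) (h3.mp h.ge)

/-- Dilations act on `L²(ℝ)`. -/
lemma exists_dilation (f : L2R) {u : ℝ} (hu : 0 < u) :
    ∃ f' : L2R, f' =ᵐ[volume] (fun x => f (u * x)) ∧ ‖f'‖ = u ^ (-1 / 2 : ℝ) * ‖f‖ := by
  have hfm : Measurable f := (Lp.stronglyMeasurable f).measurable
  have hmem : MemLp (fun x => f (u * x)) 2 volume := by
    refine ⟨(by fun_prop : Measurable fun x => f (u * x)).aestronglyMeasurable, ?_⟩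
    rw [eLpNorm_comp_mul_left f hu]
    exact ENNReal.mul_lt_top ENNReal.ofReal_lt_top (Lp.eLpNorm_lt_top f)
  refine ⟨hmem.toLp _, hmem.coeFn_toLp, ?_⟩
  rw [Lp.norm_toLp, eLpNorm_comp_mul_left f hu, ENNReal.toReal_mul,
    ENNReal.toReal_ofReal (Real.rpow_nonneg hu.le _), Lp.norm_def]

lemma inner_eq_dilationCoeff (g f f' : L2R) {u : ℝ} (hf' : f' =ᵐ[volume] fun x => f (u * x)) :
    inner ℂ g f' = dilationCoeff g f u := by
  rw [L2.inner_def]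
  apply integral_congr_ae
  filter_upwards [hf'] with x hx
  simp only [RCLike.inner_apply, hx]

/-- Cauchy–Schwarz, since dilation by u multiplies the L² norm by u^{-1/2}. -/
lemma isHalfBounded_dilationCoeff (g f : L2R) : IsHalfBounded (dilationCoeff g f) := by
  have hfm : Measurable f := (Lp.stronglyMeasurable f).measurable
  have hgm : Measurable g := (Lp.stronglyMeasurable g).measurable
  refine ⟨?_, ‖g‖ * ‖f‖, fun u hu => ?_⟩
  · apply StronglyMeasurable.measurable
    apply StronglyMeasurable.integral_prod_right'
      (f := fun p : ℝ × ℝ => f (p.1 * p.2) * (starRingEnd ℂ) (g p.2))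
    apply Measurable.stronglyMeasurable
    have : Measurable (fun x => (starRingEnd ℂ) (g x)) :=
      Complex.continuous_conj.measurable.comp hgm
    fun_prop
  · obtain ⟨f', h1, h2⟩ := exists_dilation f hu
    rw [← inner_eq_dilationCoeff g f f' h1]
    refine (norm_inner_le_norm g f').trans (le_of_eq ?_)
    rw [h2]
    ring

/-- The Schur bound places ∫|K(u)||f(ux)|du in L²; Hölder's inequality against g finishes. -/
lemma integrable_hausdorff_mul {K : ℝ → ℂ} (hK : IsHausdorffKernel K) (g f : L2R) :
    Integrable (fun p : ℝ × ℝ => K p.2 * (f (p.2 * p.1) * (starRingEnd ℂ) (g p.1))) := by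
  have hfm : Measurable f := (Lp.stronglyMeasurable f).measurable
  have hgm : Measurable g := (Lp.stronglyMeasurable g).measurable
  have hgc : Measurable (fun x => (starRingEnd ℂ) (g x)) :=
    Complex.continuous_conj.measurable.comp hgm
  have hKm := hK.aestronglyMeasurable.comp_snd (μ := (volume : Measure ℝ))
  have hm : AEStronglyMeasurable
      (fun p : ℝ × ℝ => K p.2 * (f (p.2 * p.1) * (starRingEnd ℂ) (g p.1)))
      (volume.prod volume) :=
    hKm.mul (by fun_prop : Measurable fun p : ℝ × ℝ =>
      f (p.2 * p.1) * (starRingEnd ℂ) (g p.1)).aestronglyMeasurable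
  refine ⟨hm, ?_⟩
  unfold HasFiniteIntegral
  rw [Measure.volume_eq_prod, lintegral_prod _ hm.enorm]
  have hmeas : AEMeasurable (fun x => ∫⁻ u, ‖K u‖ₑ * ‖f (u * x)‖ₑ) volume := by
    apply AEMeasurable.lintegral_prod_right' (f := fun p : ℝ × ℝ => ‖K p.2‖ₑ * ‖f (p.2 * p.1)‖ₑ)
    have := hKm.enorm
    fun_prop
  have h1 : ∀ x, ∫⁻ u, ‖K u * (f (u * x) * (starRingEnd ℂ) (g x))‖ₑ =
      (∫⁻ u, ‖K u‖ₑ * ‖f (u * x)‖ₑ) * ‖g x‖ₑ := by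
    intro x
    rw [← lintegral_mul_const' _ _ enorm_ne_top]
    congr 1 with u
    rw [enorm_mul, enorm_mul, RCLike.enorm_conj, mul_assoc]
  simp only [h1]
  refine lt_of_le_of_lt (ENNReal.lintegral_mul_le_Lp_mul_Lq volume
    (Real.HolderConjugate.two_two) hmeas hgm.enorm.aemeasurable) ?_
  simp only [ENNReal.rpow_two]
  apply ENNReal.mul_lt_top
  · apply ENNReal.rpow_lt_top_of_nonneg (by norm_num)
    refine (lt_of_le_of_lt (lintegral_hausdorff_L2 hK f) ?_).ne
    exact ENNReal.pow_lt_top (ENNReal.mul_lt_top ENNReal.ofReal_lt_top (Lp.eLpNorm_lt_top f))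
  · apply ENNReal.rpow_lt_top_of_nonneg (by norm_num)
    rw [← eLpNorm_two_sq]
    exact (ENNReal.pow_lt_top (Lp.eLpNorm_lt_top g)).ne

/-- By Fubini, the operator is seen only through integrals of K against functions of u. Operator
identities thereby become statements about kernels. -/
lemma inner_hausdorff {K : ℝ → ℂ} (hK : IsHausdorffKernel K) (g f : L2R) :
    inner ℂ g (hausdorff K hK f) = ∫ u, K u * dilationCoeff g f u := by
  rw [L2.inner_def]
  simp only [dilationCoeff, ← integral_const_mul]
  rw [← integral_integral_swap
    (f := fun x u => K u * (f (u * x) * (starRingEnd ℂ) (g x))) (integrable_hausdorff_mul hK g f)]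
  apply integral_congr_ae
  filter_upwards [hausdorff_ae K hK f] with x hx
  simp only [RCLike.inner_apply, hx]
  rw [← integral_mul_const]
  simp only [mul_assoc]

lemma integral_eq_integral_Ioi {K : ℝ → ℂ} (ha : KernelCondA K) (φ : ℝ → ℂ) :
    ∫ u, K u * φ u = ∫ u in Ioi (0 : ℝ), K u * φ u := by
  rw [← integral_indicator measurableSet_Ioi]
  apply integral_congr_ae
  filter_upwards [ha, ae_ne_zero_real] with u hu hu0
  rcases lt_or_gt_of_ne hu0 with h | h
  · rw [indicator_of_notMem (by simpa using h.le), hu h, zero_mul]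
  · rw [indicator_of_mem (show u ∈ Ioi (0 : ℝ) from h)]

lemma inner_hausdorffPlus {K : ℝ → ℂ} (ha : KernelCondA K) (hb : KernelCondB K) (g f : L2Rplus) :
    inner ℂ g (hausdorffPlus K ha hb f) =
      ∫ u in Ioi (0 : ℝ), K u * dilationCoeff (g : L2R) (f : L2R) u := by
  rw [← integral_eq_integral_Ioi ha, ← inner_hausdorff (ha.isHausdorffKernel hb)]
  rfl

/-- Hausdorff operators commute with dilations, so the dilation can be moved onto f; dilating by u
and then by v is dilating by uv. -/
lemma dilationCoeff_hausdorff {L : ℝ → ℂ} (ha : KernelCondA L) (hL : IsHausdorffKernel L)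
    (g f : L2R) {u : ℝ} (hu : 0 < u) :
    dilationCoeff g (hausdorff L hL f) u =
      ∫ v in Ioi (0 : ℝ), L v * dilationCoeff g f (u * v) := by
  obtain ⟨f', h1, -⟩ := exists_dilation f hu
  have h2 : hausdorff L hL f' =ᵐ[volume] fun x => hausdorff L hL f (u * x) := by
    filter_upwards [hausdorff_ae L hL f', hausdorffFun_congr L h1,
      (quasiMeasurePreserving_mul_left hu.ne').ae (hausdorff_ae L hL f)] with x hx1 hx2 hx3
    rw [hx1, hx3]
    unfold hausdorffFun at hx2
    rw [hx2]
    congr 1 with v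
    rw [mul_left_comm]
  rw [← inner_eq_dilationCoeff g _ _ h2, inner_hausdorff, integral_eq_integral_Ioi ha]
  apply setIntegral_congr_fun measurableSet_Ioi
  intro v hv
  have hv0 : 0 < v := hv
  simp only
  congr 1
  apply integral_congr_ae
  filter_upwards [(quasiMeasurePreserving_mul_left hv0.ne').ae h1] with x hx
  rw [hx, mul_assoc]

/-- If `ℳP = ℳK · ℳL` on the critical line, then `𝓗_K 𝓗_L = 𝓗_P`, in terms of matrix
coefficients. -/
lemma inner_hausdorffPlus_comp {K L P : ℝ → ℂ} (hK : Measurable K) (hL : Measurable L)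
    (haK : KernelCondA K) (hbK : KernelCondB K) (haL : KernelCondA L) (hbL : KernelCondB L)
    (hbP : KernelCondB P) (h : ∀ z : ℂ, z.re = 1 / 2 → mellin P z = mellin K z * mellin L z)
    (g f : L2Rplus) :
    inner ℂ g (hausdorffPlus K haK hbK (hausdorffPlus L haL hbL f)) =
      ∫ u in Ioi (0 : ℝ), P u * dilationCoeff (g : L2R) (f : L2R) u := by
  have hae := hbP.ae_eq_of_mellin_eq (kernelCondB_mulConv hK hL hbK hbL)
    (fun z hz => (h z hz).trans (mellin_mulConv hK hL hbK hbL hz).symm)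
  have hae' : ∫ u in Ioi (0 : ℝ), P u * dilationCoeff (g : L2R) (f : L2R) u =
      ∫ u in Ioi (0 : ℝ), mulConv K L u * dilationCoeff (g : L2R) (f : L2R) u :=
    integral_congr_ae (by filter_upwards [hae] with u hu; rw [hu])
  rw [inner_hausdorffPlus, hae',
    integral_mulConv_mul hK hL hbK hbL (isHalfBounded_dilationCoeff _ _)]
  apply setIntegral_congr_fun measurableSet_Ioi
  intro u hu
  simp only
  rw [← dilationCoeff_hausdorff haL (haL.isHausdorffKernel hbL) _ _ hu]
  rfl

/-! ### Kernels with Mellin transform (z - a)⁻¹ -/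

/-- The kernel `u^{-a}` on `(0, 1]`. -/
noncomputable def lowKernel (a : ℂ) : ℝ → ℂ := (Ioc (0 : ℝ) 1).indicator fun u => (u : ℂ) ^ (-a)

/-- The kernel `-u^{-a}` on `(1, ∞)`. -/
noncomputable def highKernel (a : ℂ) : ℝ → ℂ := (Ioi (1 : ℝ)).indicator fun u => -(u : ℂ) ^ (-a)

lemma measurable_lowKernel (a : ℂ) : Measurable (lowKernel a) :=
  Measurable.indicator (by fun_prop) measurableSet_Ioc

lemma measurable_highKernel (a : ℂ) : Measurable (highKernel a) :=
  Measurable.indicator (by fun_prop) measurableSet_Ioi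

lemma kernelCondA_indicator {S : Set ℝ} (hS : S ⊆ Ioi 0) (k : ℝ → ℂ) :
    KernelCondA (S.indicator k) :=
  .of_forall fun _ hu => indicator_of_notMem (fun h => (lt_asymm hu (hS h)).elim) _

lemma kernelCondB_indicator {S : Set ℝ} (hSm : MeasurableSet S) {k : ℝ → ℂ}
    (h : IntegrableOn (fun u : ℝ => k u * ((u ^ (-1 / 2 : ℝ) : ℝ) : ℂ)) S) :
    KernelCondB (S.indicator k) := by
  have h1 : (fun u : ℝ => S.indicator k u * ((u ^ (-1 / 2 : ℝ) : ℝ) : ℂ)) =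
      S.indicator (fun u : ℝ => k u * ((u ^ (-1 / 2 : ℝ) : ℝ) : ℂ)) := by
    funext u
    by_cases hu : u ∈ S <;> simp [hu]
  unfold KernelCondB
  rw [h1]
  exact ((integrable_indicator_iff hSm).mpr h).integrableOn

lemma Ioc_zero_one_subset : Ioc (0 : ℝ) 1 ⊆ Ioi 0 := fun _ h => h.1

lemma Ioi_one_subset : Ioi (1 : ℝ) ⊆ Ioi 0 := Ioi_subset_Ioi zero_le_one

lemma kernelCondA_lowKernel (a : ℂ) : KernelCondA (lowKernel a) :=
  kernelCondA_indicator Ioc_zero_one_subset _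

lemma kernelCondA_highKernel (a : ℂ) : KernelCondA (highKernel a) :=
  kernelCondA_indicator Ioi_one_subset _

lemma cpow_mul_rpow {u : ℝ} (hu : 0 < u) (a : ℂ) (s : ℝ) :
    (u : ℂ) ^ a * ((u ^ s : ℝ) : ℂ) = (u : ℂ) ^ (a + s) := by
  rw [Complex.ofReal_cpow hu.le, Complex.cpow_add _ _ (by exact_mod_cast hu.ne')]

lemma kernelCondB_lowKernel {a : ℂ} (h : a.re < 1 / 2) : KernelCondB (lowKernel a) := by
  apply kernelCondB_indicator measurableSet_Ioc
  have h1 := intervalIntegral.intervalIntegrable_cpow' (a := 0) (b := 1)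
    (r := -a + ((-1 / 2 : ℝ) : ℂ)) (by simp; linarith)
  rw [intervalIntegrable_iff_integrableOn_Ioc_of_le zero_le_one] at h1
  exact h1.congr_fun (fun u hu => (cpow_mul_rpow hu.1 _ _).symm) measurableSet_Ioc

lemma kernelCondB_highKernel {a : ℂ} (h : 1 / 2 < a.re) : KernelCondB (highKernel a) := by
  apply kernelCondB_indicator measurableSet_Ioi
  have h1 := integrableOn_Ioi_cpow_of_lt (a := -a + ((-1 / 2 : ℝ) : ℂ)) (by simp; linarith)
    zero_lt_one
  refine (h1.neg).congr_fun (fun u hu => ?_) measurableSet_Ioi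
  rw [Pi.neg_apply, ← cpow_mul_rpow (Ioi_one_subset hu), neg_mul]

/-- Both kernels have the same transform; the side of the critical line on which a lies decides
which of them satisfies (b). The sign in `highKernel` makes the two formulas agree. -/
lemma mellin_lowKernel {a z : ℂ} (ha : a.re < 1 / 2) (hz : z.re = 1 / 2) :
    mellin (lowKernel a) z = (z - a)⁻¹ := by
  have h := (hasMellin_cpow_Ioc (-a) (s := z) (by simp; linarith)).2
  rw [lowKernel, h, one_div, sub_eq_add_neg]

lemma mellin_highKernel {a z : ℂ} (ha : 1 / 2 < a.re) (hz : z.re = 1 / 2) :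
    mellin (highKernel a) z = (z - a)⁻¹ := by
  have h1 : ∀ u : ℝ, (u : ℂ) ^ (z - 1) • highKernel a u =
      (Ioi (1 : ℝ)).indicator (fun u => -(u : ℂ) ^ (z - 1 - a)) u := by
    intro u
    by_cases hu : u ∈ Ioi (1 : ℝ)
    · have hu0 : (u : ℂ) ≠ 0 := by exact_mod_cast (Ioi_one_subset hu).ne'
      rw [highKernel, indicator_of_mem hu, indicator_of_mem hu, smul_eq_mul, mul_neg,
        ← Complex.cpow_add _ _ hu0, sub_eq_add_neg (z - 1)]
    · rw [highKernel, indicator_of_notMem hu, indicator_of_notMem hu, smul_zero]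
  have hne : z - a ≠ 0 := fun h => by
    have := congrArg Complex.re h
    simp at this
    linarith
  simp only [mellin, h1]
  rw [setIntegral_indicator measurableSet_Ioi, inter_eq_self_of_subset_right Ioi_one_subset,
    integral_neg, integral_Ioi_cpow_of_lt (by simp; linarith) zero_lt_one, Complex.ofReal_one,
    Complex.one_cpow, neg_div, neg_neg, one_div]
  congr 1
  ring

/-! ### The resolvent and the spectrum of the Cesàro operator -/

lemma mellin_cesaroKernel {z : ℂ} (hz : z.re = 1 / 2) : mellin cesaroKernel z = z⁻¹ := by
  have h := mellin_lowKernel (a := 0) (by simp) hz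
  rw [sub_zero] at h
  rw [← h]
  apply integral_congr_ae
  apply ae_restrict_of_ae
  -- The Cesàro kernel and `lowKernel 0` differ only at the endpoint 1.
  have h1 : ∀ᵐ u : ℝ, u ≠ 1 := by simp [ae_iff, measure_singleton]
  filter_upwards [h1] with u hu
  congr 1
  simp only [cesaroKernel, lowKernel, indicator, mem_Ioo, mem_Ioc, neg_zero, Complex.cpow_zero,
    Pi.one_apply, lt_iff_le_and_ne, and_iff_left hu]

lemma measurable_cesaroKernel : Measurable cesaroKernel :=
  measurable_one.indicator measurableSet_Ioo

/-- Linearity of K ↦ 𝓗_K in weak form, for the combination that appears in the resolvent equation.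
-/
lemma inner_hausdorffPlus_eq_of_mellin {w : ℂ} {κ : ℝ → ℂ} (ha : KernelCondA κ)
    (hb : KernelCondB κ) (g f : L2Rplus) :
    ∫ u in Ioi (0 : ℝ), w * (κ u - cesaroKernel u) * dilationCoeff (g : L2R) (f : L2R) u =
      inner ℂ g (w • (hausdorffPlus κ ha hb f - cesaroPlus f)) := by
  have hc : cesaroPlus = hausdorffPlus cesaroKernel cesaroKernel_condA cesaroKernel_condB := rfl
  have hφ := isHalfBounded_dilationCoeff (g : L2R) (f : L2R)
  refine Eq.trans ?_ (inner_smul_right g _ w).symm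
  rw [inner_sub_right, hc, inner_hausdorffPlus, inner_hausdorffPlus,
    ← integral_sub (hb.integrableOn_mul hφ) (cesaroKernel_condB.integrableOn_mul hφ),
    ← integral_const_mul]
  congr 1 with u
  ring

section algebra

variable {A : Type*} [Ring A] [Algebra ℂ A] {w : ℂ} {C H : A}

/-- On the Mellin side C is z⁻¹ and H is (z - w⁻¹)⁻¹, and the hypothesis is their partial fraction
identity. The inverse is modelled on (w - z⁻¹)⁻¹ = w⁻¹ + w⁻²(z - w⁻¹)⁻¹. -/
lemma resolvent_right_inverse (hw : w ≠ 0) (h : C * H = w • (H - C)) :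
    (algebraMap ℂ A w - C) * (w⁻¹ • 1 + (w ^ 2)⁻¹ • H) = 1 := by
  have e1 : w⁻¹ * w = 1 := inv_mul_cancel₀ hw
  have e2 : (w ^ 2)⁻¹ * w = w⁻¹ := by field_simp
  simp only [Algebra.algebraMap_eq_smul_one, sub_mul, mul_add, smul_mul_assoc,
    mul_smul_comm, one_mul, mul_one, one_smul, h, smul_smul, e1, e2, smul_sub]
  abel

lemma resolvent_left_inverse (hw : w ≠ 0) (h : H * C = w • (H - C)) :
    (w⁻¹ • 1 + (w ^ 2)⁻¹ • H) * (algebraMap ℂ A w - C) = 1 := by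
  have e2 : (w ^ 2)⁻¹ * w = w⁻¹ := by field_simp
  simp only [Algebra.algebraMap_eq_smul_one, mul_sub, add_mul, smul_mul_assoc,
    mul_smul_comm, one_mul, mul_one, h, smul_smul, smul_add, mul_inv_cancel₀ hw, mul_comm w (w ^ 2)⁻¹, one_smul, e2,
    smul_sub]
  abel

end algebra

/-- The resolvent of the Cesàro operator. -/
lemma isUnit_and_resolvent_cesaroPlus {w : ℂ} (hw : w ≠ 0) {κ : ℝ → ℂ} (hm : Measurable κ)
    (ha : KernelCondA κ) (hb : KernelCondB κ)
    (hκ : ∀ z : ℂ, z.re = 1 / 2 → z - w⁻¹ ≠ 0 ∧ mellin κ z = (z - w⁻¹)⁻¹) :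
    w ∈ resolventSet ℂ cesaroPlus ∧
      resolvent cesaroPlus w = w⁻¹ • 1 + (w ^ 2)⁻¹ • hausdorffPlus κ ha hb := by
  set H := hausdorffPlus κ ha hb
  have hbP : KernelCondB fun u => w * (κ u - cesaroKernel u) :=
    (hb.sub cesaroKernel_condB).const_mul w
  have hP : ∀ z : ℂ, z.re = 1 / 2 →
      mellin (fun u => w * (κ u - cesaroKernel u)) z = mellin κ z * mellin cesaroKernel z := by
    intro z hz
    have hz0 : z ≠ 0 := fun h => by simp [h] at hz
    obtain ⟨h1, h2⟩ := hκ z hz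
    have h3 := hasMellin_sub (hb.mellinConvergent hz) (cesaroKernel_condB.mellinConvergent hz)
    have h4 := mellin_const_smul (fun u => κ u - cesaroKernel u) z w
    simp only [smul_eq_mul] at h4
    rw [h4, h3.2, mellin_cesaroKernel hz, h2]
    rw [inv_sub_inv h1 hz0, sub_sub_cancel, ← mul_div_assoc, mul_inv_cancel₀ hw, one_div, mul_inv]
  have h1 : cesaroPlus * H = w • (H - cesaroPlus) := by
    ext1 f
    refine ext_inner_left ℂ fun g => ?_
    refine Eq.trans ?_ (inner_hausdorffPlus_eq_of_mellin ha hb g f)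
    exact inner_hausdorffPlus_comp measurable_cesaroKernel hm cesaroKernel_condA
      cesaroKernel_condB ha hb hbP
      (fun z hz => (hP z hz).trans (mul_comm _ _)) g f
  have h2 : H * cesaroPlus = w • (H - cesaroPlus) := by
    ext1 f
    refine ext_inner_left ℂ fun g => ?_
    refine Eq.trans ?_ (inner_hausdorffPlus_eq_of_mellin ha hb g f)
    exact inner_hausdorffPlus_comp hm measurable_cesaroKernel ha hb cesaroKernel_condA
      cesaroKernel_condB hbP hP g f
  have h3 := resolvent_right_inverse hw h1
  have h4 := resolvent_left_inverse hw h2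
  let U : (L2Rplus →L[ℂ] L2Rplus)ˣ := ⟨_, _, h3, h4⟩
  exact ⟨⟨U, rfl⟩, Ring.inverse_unit U⟩

/-- Both inequalities say |w|² > 2 Re w: inversion takes the exterior of 𝕋 + 1 to the half-plane
left of the critical line. -/
lemma inv_re_lt_half {w : ℂ} (hw : 1 < ‖w - 1‖) : w ≠ 0 ∧ w⁻¹.re < 1 / 2 := by
  have h0 : w ≠ 0 := by
    rintro rfl
    simp at hw
  refine ⟨h0, ?_⟩
  have h1 : 1 < ‖w - 1‖ ^ 2 := by nlinarith
  have h2 := Complex.normSq_pos.mpr h0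
  rw [← Complex.normSq_eq_norm_sq, Complex.normSq_apply] at h1
  rw [Complex.inv_re, div_lt_iff₀ h2, Complex.normSq_apply]
  simp at h1
  linarith

lemma half_lt_inv_re {w : ℂ} (hw : ‖w - 1‖ < 1) : w ≠ 0 ∧ 1 / 2 < w⁻¹.re := by
  have h0 : w ≠ 0 := by
    rintro rfl
    simp at hw
  refine ⟨h0, ?_⟩
  have h1 : ‖w - 1‖ ^ 2 < 1 := by nlinarith [norm_nonneg (w - 1)]
  have h2 := Complex.normSq_pos.mpr h0
  rw [← Complex.normSq_eq_norm_sq, Complex.normSq_apply] at h1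
  rw [Complex.inv_re, lt_div_iff₀ h2, Complex.normSq_apply]
  simp at h1
  linarith

lemma sub_ne_zero_of_re_ne {z a : ℂ} (h : z.re ≠ a.re) : z - a ≠ 0 :=
  fun h' => h (congrArg Complex.re (sub_eq_zero.mp h'))

lemma resolvent_cesaroPlus_of_gt {w : ℂ} (hw : 1 < ‖w - 1‖) :
    w ∈ resolventSet ℂ cesaroPlus ∧ resolvent cesaroPlus w = w⁻¹ • 1 + (w ^ 2)⁻¹ •
      hausdorffPlus (lowKernel w⁻¹) (kernelCondA_lowKernel _)
        (kernelCondB_lowKernel (inv_re_lt_half hw).2) := by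
  obtain ⟨h0, h1⟩ := inv_re_lt_half hw
  exact isUnit_and_resolvent_cesaroPlus h0 (measurable_lowKernel _) _ _ fun z hz =>
    ⟨sub_ne_zero_of_re_ne (by linarith), mellin_lowKernel h1 hz⟩

lemma resolvent_cesaroPlus_of_lt {w : ℂ} (hw : ‖w - 1‖ < 1) :
    w ∈ resolventSet ℂ cesaroPlus ∧ resolvent cesaroPlus w = w⁻¹ • 1 + (w ^ 2)⁻¹ •
      hausdorffPlus (highKernel w⁻¹) (kernelCondA_highKernel _)
        (kernelCondB_highKernel (half_lt_inv_re hw).2) := by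
  obtain ⟨h0, h1⟩ := half_lt_inv_re hw
  exact isUnit_and_resolvent_cesaroPlus h0 (measurable_highKernel _) _ _ fun z hz =>
    ⟨sub_ne_zero_of_re_ne (by linarith), mellin_highKernel h1 hz⟩

lemma spectrum_cesaroPlus_subset : spectrum ℂ cesaroPlus ⊆ Metric.sphere (1 : ℂ) 1 := by
  intro w hw
  rw [mem_sphere_iff_norm]
  by_contra hne
  rcases lt_or_gt_of_ne hne with h | h
  · exact hw (resolvent_cesaroPlus_of_lt h).1
  · exact hw (resolvent_cesaroPlus_of_gt h).1

/-! ### The kernel of the Riesz–Dunford integral -/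

lemma ne_zero_of_mem_sphere_one {ρ : ℝ} (hρ1 : ρ ≠ 1) {w : ℂ}
    (hw : w ∈ Metric.sphere (1 : ℂ) ρ) : w ≠ 0 := by
  rintro rfl
  rw [mem_sphere_iff_norm] at hw
  simp at hw
  exact hρ1 hw.symm

/-- The integral `(1/2πi) ∮ F(w) w⁻² u^{-1/w} dw` over the circle `|w - 1| = ρ`. -/
noncomputable def circleKernel (F : ℂ → ℂ) (ρ : ℝ) (u : ℝ) : ℂ :=
  (2 * (Real.pi : ℂ) * Complex.I)⁻¹ *
    ∮ w in C(1, ρ), F w * (w ^ 2)⁻¹ * (u : ℂ) ^ (-w⁻¹)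

section circle

variable {F : ℂ → ℂ} {ρ : ℝ}

lemma continuous_circle_weight (hF : ContinuousOn F (Metric.sphere 1 ρ)) (hρ0 : 0 < ρ)
    (hρ1 : ρ ≠ 1) :
    Continuous (fun θ : ℝ => deriv (circleMap 1 ρ) θ *
      (F (circleMap 1 ρ θ) * (circleMap 1 ρ θ ^ 2)⁻¹)) := by
  have h1 : Continuous fun θ : ℝ => F (circleMap 1 ρ θ) :=
    hF.comp_continuous (continuous_circleMap 1 ρ) (circleMap_mem_sphere 1 hρ0.le)
  have h2 : ∀ θ, circleMap 1 ρ θ ^ 2 ≠ 0 := fun θ =>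
    pow_ne_zero 2 (ne_zero_of_mem_sphere_one hρ1 (circleMap_mem_sphere 1 hρ0.le θ))
  have h3 : Continuous fun θ : ℝ => (circleMap 1 ρ θ ^ 2)⁻¹ :=
    ((continuous_circleMap 1 ρ).pow 2).inv₀ h2
  simp only [deriv_circleMap]
  exact ((continuous_circleMap 0 ρ).mul continuous_const).mul (h1.mul h3)

lemma measurable_circle_cpow :
    Measurable (fun p : ℝ × ℝ => (p.2 : ℂ) ^ (-(circleMap 1 ρ p.1)⁻¹)) := by
  have h := (continuous_circleMap 1 ρ).measurable
  fun_prop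

lemma measurable_circleKernel (hF : ContinuousOn F (Metric.sphere 1 ρ)) (hρ0 : 0 < ρ)
    (hρ1 : ρ ≠ 1) : Measurable (circleKernel F ρ) := by
  unfold circleKernel
  apply Measurable.const_mul
  simp only [circleIntegral, intervalIntegral.integral_of_le Real.two_pi_pos.le, smul_eq_mul]
  apply StronglyMeasurable.measurable
  apply StronglyMeasurable.integral_prod_left'
    (f := fun p : ℝ × ℝ => deriv (circleMap 1 ρ) p.1 *
      (F (circleMap 1 ρ p.1) * (circleMap 1 ρ p.1 ^ 2)⁻¹ * (p.2 : ℂ) ^ (-(circleMap 1 ρ p.1)⁻¹)))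
  apply Measurable.stronglyMeasurable
  have h1 := (continuous_circle_weight hF hρ0 hρ1).measurable
  have h2 := (h1.comp measurable_fst).mul (measurable_circle_cpow (ρ := ρ))
  convert h2 using 1
  funext p
  simp only [Pi.mul_apply, Function.comp]
  ring

variable {S : Set ℝ} {α : ℝ} {φ : ℝ → ℂ}

/-- One exponent α dominates u^{-1/w} for all w on the circle. The integrand is then bounded by a
continuous function of the angle times a multiple of u^{-α-1/2}. -/
lemma integrable_circle_kernel (hF : ContinuousOn F (Metric.sphere 1 ρ)) (hρ0 : 0 < ρ)
    (hρ1 : ρ ≠ 1) (hSm : MeasurableSet S) (hS : S ⊆ Ioi 0)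
    (hα : ∀ w ∈ Metric.sphere (1 : ℂ) ρ, ∀ u ∈ S, u ^ (-w⁻¹.re) ≤ u ^ (-α))
    (hint : IntegrableOn (fun u : ℝ => u ^ (-α - 1 / 2)) S) (hφ : IsHalfBounded φ) :
    Integrable (fun p : ℝ × ℝ => deriv (circleMap 1 ρ) p.1 *
      (F (circleMap 1 ρ p.1) * (circleMap 1 ρ p.1 ^ 2)⁻¹) *
        ((p.2 : ℂ) ^ (-(circleMap 1 ρ p.1)⁻¹) * φ p.2))
      ((volume.restrict (uIoc 0 (2 * Real.pi))).prod (volume.restrict S)) := by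
  obtain ⟨hm, B, hB⟩ := hφ
  have hc := continuous_circle_weight hF hρ0 hρ1
  have h1 : IntegrableOn (fun θ : ℝ => deriv (circleMap 1 ρ) θ *
      (F (circleMap 1 ρ θ) * (circleMap 1 ρ θ ^ 2)⁻¹)) (uIoc 0 (2 * Real.pi)) :=
    intervalIntegrable_iff.mp (hc.intervalIntegrable 0 (2 * Real.pi))
  have h2 := Integrable.mul_prod (Integrable.norm h1) (hint.const_mul B)
  refine h2.mono' ?_ ?_
  · apply Measurable.aestronglyMeasurable
    have := hc.measurable
    have h3 := measurable_circle_cpow (ρ := ρ)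
    exact (this.comp measurable_fst).mul (h3.mul (hm.comp measurable_snd))
  · rw [Measure.prod_restrict]
    filter_upwards [ae_restrict_mem (measurableSet_uIoc.prod hSm)] with p hp
    have hp0 : 0 < p.2 := hS hp.2
    rw [norm_mul]
    refine mul_le_mul_of_nonneg_left ?_ (norm_nonneg _)
    rw [norm_mul, Complex.norm_cpow_eq_rpow_re_of_pos hp0, Complex.neg_re]
    calc _ ≤ p.2 ^ (-α) * (B * p.2 ^ (-1 / 2 : ℝ)) :=
          mul_le_mul (hα _ (circleMap_mem_sphere 1 hρ0.le _) _ hp.2) (hB _ hp0) (norm_nonneg _)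
            (Real.rpow_nonneg hp0.le _)
      _ = B * p.2 ^ (-α - 1 / 2) := by
          rw [mul_left_comm, ← Real.rpow_add hp0]
          ring_nf

/-- Fubini's theorem for the circle kernel, together with the integrability of both sides. -/
lemma integral_circleKernel_mul (hF : ContinuousOn F (Metric.sphere 1 ρ)) (hρ0 : 0 < ρ)
    (hρ1 : ρ ≠ 1) (hSm : MeasurableSet S) (hS : S ⊆ Ioi 0)
    (hα : ∀ w ∈ Metric.sphere (1 : ℂ) ρ, ∀ u ∈ S, u ^ (-w⁻¹.re) ≤ u ^ (-α))
    (hint : IntegrableOn (fun u : ℝ => u ^ (-α - 1 / 2)) S) (hφ : IsHalfBounded φ) :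
    IntegrableOn (fun u => circleKernel F ρ u * φ u) S ∧
    CircleIntegrable (fun w => F w * (w ^ 2)⁻¹ * ∫ u in S, (u : ℂ) ^ (-w⁻¹) * φ u) 1 ρ ∧
    ∫ u in S, circleKernel F ρ u * φ u = (2 * (Real.pi : ℂ) * Complex.I)⁻¹ *
      ∮ w in C(1, ρ), F w * (w ^ 2)⁻¹ * ∫ u in S, (u : ℂ) ^ (-w⁻¹) * φ u := by
  have hI := integrable_circle_kernel hF hρ0 hρ1 hSm hS hα hint hφ
  have e : ∀ u, circleKernel F ρ u * φ u = (2 * (Real.pi : ℂ) * Complex.I)⁻¹ *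
      ∫ θ in (0 : ℝ)..2 * Real.pi, deriv (circleMap 1 ρ) θ *
        (F (circleMap 1 ρ θ) * (circleMap 1 ρ θ ^ 2)⁻¹) *
          ((u : ℂ) ^ (-(circleMap 1 ρ θ)⁻¹) * φ u) := by
    intro u
    simp only [circleKernel, circleIntegral, smul_eq_mul]
    rw [mul_assoc, ← intervalIntegral.integral_mul_const]
    congr 2 with θ
    ring
  refine ⟨?_, ?_, ?_⟩
  · simp only [e]
    have h := hI.integral_prod_right
    rw [uIoc_of_le Real.two_pi_pos.le] at h
    simp only [intervalIntegral.integral_of_le Real.two_pi_pos.le]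
    exact Integrable.const_mul h _
  · rw [circleIntegrable_iff _ ]
    rw [intervalIntegrable_iff]
    refine hI.integral_prod_left.congr (.of_forall fun θ => ?_)
    simp only [deriv_circleMap, smul_eq_mul]
    rw [integral_const_mul]
    ring
  · simp only [e]
    rw [integral_const_mul, ← intervalIntegral_integral_swap hI]
    congr 1
    simp only [circleIntegral, smul_eq_mul]
    congr 1 with θ
    rw [integral_const_mul]
    ring

end circle

section sphere

variable {ρ : ℝ}

lemma continuousOn_inv_re_sphere (hρ1 : ρ ≠ 1) :
    ContinuousOn (fun w : ℂ => w⁻¹.re) (Metric.sphere 1 ρ) :=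
  Complex.continuous_re.comp_continuousOn
    (continuousOn_inv₀.mono fun _ hw => ne_zero_of_mem_sphere_one hρ1 hw)

/-- By compactness Re w⁻¹ attains its maximum on the circle, and that maximum is still below 1/2.
This slack makes u^{-α-1/2} integrable at 0. -/
lemma exists_exponent_of_gt (hρ : 1 < ρ) : ∃ α : ℝ, α < 1 / 2 ∧
    ∀ w ∈ Metric.sphere (1 : ℂ) ρ, ∀ u ∈ Ioc (0 : ℝ) 1, u ^ (-w⁻¹.re) ≤ u ^ (-α) := by
  obtain ⟨w0, h0, hmax⟩ := (isCompact_sphere (1 : ℂ) ρ).exists_isMaxOn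
    (NormedSpace.sphere_nonempty.mpr (by linarith)) (continuousOn_inv_re_sphere hρ.ne')
  refine ⟨w0⁻¹.re, (inv_re_lt_half ?_).2, fun w hw u hu => ?_⟩
  · rwa [mem_sphere_iff_norm.mp h0]
  · exact Real.rpow_le_rpow_of_exponent_ge hu.1 hu.2 (neg_le_neg (hmax hw))

lemma exists_exponent_of_lt (hρ0 : 0 < ρ) (hρ : ρ < 1) : ∃ α : ℝ, 1 / 2 < α ∧
    ∀ w ∈ Metric.sphere (1 : ℂ) ρ, ∀ u ∈ Ioi (1 : ℝ), u ^ (-w⁻¹.re) ≤ u ^ (-α) := by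
  obtain ⟨w0, h0, hmin⟩ := (isCompact_sphere (1 : ℂ) ρ).exists_isMinOn
    (NormedSpace.sphere_nonempty.mpr hρ0.le) (continuousOn_inv_re_sphere hρ.ne)
  refine ⟨w0⁻¹.re, (half_lt_inv_re ?_).2, fun w hw u hu => ?_⟩
  · rwa [mem_sphere_iff_norm.mp h0]
  · exact Real.rpow_le_rpow_of_exponent_le (le_of_lt hu) (neg_le_neg (hmin hw))

end sphere

/-- The kernel of `F(𝒞₊) - F(0)`. -/
noncomputable def annulusKernel (F : ℂ → ℂ) (r R : ℝ) : ℝ → ℂ :=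
  (Ioi (0 : ℝ)).indicator fun u => if u ≤ 1 then circleKernel F R u else circleKernel F r u

section annulus

variable {F : ℂ → ℂ} {r R : ℝ} {φ : ℝ → ℂ}

lemma integral_lowKernel_mul (a : ℂ) (φ : ℝ → ℂ) :
    ∫ u in Ioi (0 : ℝ), lowKernel a u * φ u = ∫ u in Ioc (0 : ℝ) 1, (u : ℂ) ^ (-a) * φ u := by
  simp only [lowKernel, ← indicator_mul_left]
  rw [setIntegral_indicator measurableSet_Ioc, inter_eq_self_of_subset_right Ioc_zero_one_subset]

lemma integral_highKernel_mul (a : ℂ) (φ : ℝ → ℂ) :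
    ∫ u in Ioi (0 : ℝ), highKernel a u * φ u = -∫ u in Ioi (1 : ℝ), (u : ℂ) ^ (-a) * φ u := by
  simp only [highKernel, ← indicator_mul_left]
  rw [setIntegral_indicator measurableSet_Ioi, inter_eq_self_of_subset_right Ioi_one_subset,
    ← integral_neg]
  simp only [neg_mul]

lemma annulusKernel_mul_eqOn_low : EqOn (fun u => circleKernel F R u * φ u)
    (fun u => annulusKernel F r R u * φ u) (Ioc 0 1) := by
  intro u hu
  simp [annulusKernel, indicator_of_mem (Ioc_zero_one_subset hu), hu.2]

lemma annulusKernel_mul_eqOn_high : EqOn (fun u => circleKernel F r u * φ u)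
    (fun u => annulusKernel F r R u * φ u) (Ioi 1) := by
  intro u hu
  simp [annulusKernel, indicator_of_mem (Ioi_one_subset hu), not_le.mpr (mem_Ioi.mp hu)]

lemma circleKernel_low (hR : 1 < R) (hF : ContinuousOn F (Metric.sphere 1 R))
    (hφ : IsHalfBounded φ) :
    IntegrableOn (fun u => circleKernel F R u * φ u) (Ioc 0 1) ∧
    CircleIntegrable (fun w => F w * (w ^ 2)⁻¹ *
      ∫ u in Ioi (0 : ℝ), lowKernel w⁻¹ u * φ u) 1 R ∧
    ∫ u in Ioc 0 1, circleKernel F R u * φ u = (2 * (Real.pi : ℂ) * Complex.I)⁻¹ *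
      ∮ w in C(1, R), F w * (w ^ 2)⁻¹ * ∫ u in Ioi (0 : ℝ), lowKernel w⁻¹ u * φ u := by
  obtain ⟨α, hα, h⟩ := exists_exponent_of_gt hR
  simp only [integral_lowKernel_mul]
  refine integral_circleKernel_mul hF (by linarith) hR.ne' measurableSet_Ioc
    Ioc_zero_one_subset h ?_ hφ
  have h1 := intervalIntegral.intervalIntegrable_rpow' (a := 0) (b := 1)
    (r := -α - 1 / 2) (by linarith)
  rwa [intervalIntegrable_iff_integrableOn_Ioc_of_le zero_le_one] at h1

/-- The minus sign is that of `highKernel`. It cancels the negative orientation of the inner circle,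
so both pieces of `annulusKernel` carry the same sign. -/
lemma circleKernel_high (hr0 : 0 < r) (hr : r < 1) (hF : ContinuousOn F (Metric.sphere 1 r))
    (hφ : IsHalfBounded φ) :
    IntegrableOn (fun u => circleKernel F r u * φ u) (Ioi 1) ∧
    CircleIntegrable (fun w => F w * (w ^ 2)⁻¹ *
      ∫ u in Ioi (0 : ℝ), highKernel w⁻¹ u * φ u) 1 r ∧
    ∫ u in Ioi 1, circleKernel F r u * φ u = -((2 * (Real.pi : ℂ) * Complex.I)⁻¹ *
      ∮ w in C(1, r), F w * (w ^ 2)⁻¹ * ∫ u in Ioi (0 : ℝ), highKernel w⁻¹ u * φ u) := by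
  obtain ⟨α, hα, h⟩ := exists_exponent_of_lt hr0 hr
  obtain ⟨h1, h2, h3⟩ := integral_circleKernel_mul hF hr0 hr.ne measurableSet_Ioi
    Ioi_one_subset h (integrableOn_Ioi_rpow_of_lt (by linarith) zero_lt_one) hφ
  have e : ∀ w : ℂ, F w * (w ^ 2)⁻¹ * ∫ u in Ioi (0 : ℝ), highKernel w⁻¹ u * φ u =
      (-1 : ℂ) • (F w * (w ^ 2)⁻¹ * ∫ u in Ioi (1 : ℝ), (u : ℂ) ^ (-w⁻¹) * φ u) := by
    intro w
    rw [integral_highKernel_mul, smul_eq_mul]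
    ring
  simp only [e]
  refine ⟨h1, h2.const_smul, ?_⟩
  rw [h3, circleIntegral.integral_smul, smul_eq_mul]
  ring

lemma annulusKernel_integral (hr0 : 0 < r) (hr : r < 1) (hR : 1 < R)
    (hFr : ContinuousOn F (Metric.sphere 1 r)) (hFR : ContinuousOn F (Metric.sphere 1 R))
    (hφ : IsHalfBounded φ) :
    IntegrableOn (fun u => annulusKernel F r R u * φ u) (Ioi 0) ∧
    ∫ u in Ioi (0 : ℝ), annulusKernel F r R u * φ u = (2 * (Real.pi : ℂ) * Complex.I)⁻¹ *
      ((∮ w in C(1, R), F w * (w ^ 2)⁻¹ * ∫ u in Ioi (0 : ℝ), lowKernel w⁻¹ u * φ u) -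
        ∮ w in C(1, r), F w * (w ^ 2)⁻¹ * ∫ u in Ioi (0 : ℝ), highKernel w⁻¹ u * φ u) := by
  obtain ⟨l1, -, l3⟩ := circleKernel_low hR hFR hφ
  obtain ⟨h1, -, h3⟩ := circleKernel_high hr0 hr hFr hφ
  have l1' := l1.congr_fun (annulusKernel_mul_eqOn_low (r := r)) measurableSet_Ioc
  have h1' := h1.congr_fun (annulusKernel_mul_eqOn_high (R := R)) measurableSet_Ioi
  rw [setIntegral_congr_fun measurableSet_Ioc (annulusKernel_mul_eqOn_low (r := r))] at l3
  rw [setIntegral_congr_fun measurableSet_Ioi (annulusKernel_mul_eqOn_high (R := R))] at h3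
  rw [← Ioc_union_Ioi_eq_Ioi (zero_le_one : (0 : ℝ) ≤ 1)]
  refine ⟨l1'.union h1', ?_⟩
  rw [setIntegral_union Ioc_disjoint_Ioi_same measurableSet_Ioi l1' h1', l3, h3]
  rw [Ioc_union_Ioi_eq_Ioi (zero_le_one : (0 : ℝ) ≤ 1)]
  ring

lemma kernelCondA_annulusKernel : KernelCondA (annulusKernel F r R) :=
  kernelCondA_indicator subset_rfl _

lemma measurable_annulusKernel (hr0 : 0 < r) (hr : r < 1) (hR : 1 < R)
    (hFr : ContinuousOn F (Metric.sphere 1 r)) (hFR : ContinuousOn F (Metric.sphere 1 R)) :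
    Measurable (annulusKernel F r R) :=
  (Measurable.ite measurableSet_Iic (measurable_circleKernel hFR (by linarith) hR.ne')
    (measurable_circleKernel hFr hr0 hr.ne)).indicator measurableSet_Ioi

end annulus

/-! ### Cauchy's formula on the annulus and the Mellin transform of the kernel -/

namespace IsAdmissibleAnnulus

variable {N : Set ℂ} {r R : ℝ} {F : ℂ → ℂ}

lemma sphere_inner_subset (h : IsAdmissibleAnnulus N r R) : Metric.sphere 1 r ⊆ N := by
  obtain ⟨h0, h1, h2, h3⟩ := h
  intro w hw
  have := mem_sphere_iff_norm.mp hw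
  exact h3 w (by linarith) (by linarith)

lemma sphere_outer_subset (h : IsAdmissibleAnnulus N r R) : Metric.sphere 1 R ⊆ N := by
  obtain ⟨h0, h1, h2, h3⟩ := h
  intro w hw
  have := mem_sphere_iff_norm.mp hw
  exact h3 w (by linarith) (by linarith)

/-- Cauchy's theorem on an annulus. -/
lemma circleIntegral_eq (h : IsAdmissibleAnnulus N r R) (hN : IsOpen N)
    (hF : DifferentiableOn ℂ F N) : ∮ w in C(1, R), F w = ∮ w in C(1, r), F w := by
  obtain ⟨h0, h1, h2, h3⟩ := h
  refine Complex.circleIntegral_eq_of_differentiable_on_annulus_off_countable h0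
    (by linarith) countable_empty (hF.continuousOn.mono ?_) ?_
  · intro w hw
    have hw1 := mem_closedBall_iff_norm.mp hw.1
    have hw2 := hw.2
    rw [mem_ball_iff_norm, not_lt] at hw2
    exact h3 w hw2 hw1
  · intro w hw
    have hw1 := mem_ball_iff_norm.mp hw.1.1
    have hw2 := hw.1.2
    rw [mem_closedBall_iff_norm, not_le] at hw2
    exact hF.differentiableAt (hN.mem_nhds (h3 w hw2.le hw1.le))

/-- Cauchy's integral formula on an annulus. -/
lemma cauchy (h : IsAdmissibleAnnulus N r R) (hN : IsOpen N) (hF : DifferentiableOn ℂ F N)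
    {a : ℂ} (ha : a ∈ Metric.sphere (1 : ℂ) 1) :
    (∮ w in C(1, R), F w * (w - a)⁻¹) - ∮ w in C(1, r), F w * (w - a)⁻¹ =
      2 * (Real.pi : ℂ) * Complex.I * F a := by
  have hr0 := h.1
  have hr1 := h.2.1
  have hR := h.2.2.1
  have ha' := mem_sphere_iff_norm.mp ha
  have haN : a ∈ N := h.2.2.2 a (by linarith) (by linarith)
  -- The difference quotient of F is holomorphic across a, so its integrals over the two circles
  -- cancel. There remains F(a)∮(w - a)⁻¹dw, which is 2πiF(a) on the outer circle and 0 on the inner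
  -- one.
  have hd : DifferentiableOn ℂ (dslope F a) N :=
    (Complex.differentiableOn_dslope (hN.mem_nhds haN)).mpr hF
  have key : ∀ ρ : ℝ, 0 < ρ → ρ ≠ 1 → Metric.sphere 1 ρ ⊆ N →
      ∮ w in C(1, ρ), F w * (w - a)⁻¹ =
        (∮ w in C(1, ρ), dslope F a w) + F a * ∮ w in C(1, ρ), (w - a)⁻¹ := by
    intro ρ hρ0 hρ1 hρ
    have hne : ∀ w ∈ Metric.sphere (1 : ℂ) ρ, w - a ≠ 0 := by
      intro w hw hwa
      rw [sub_eq_zero.mp hwa] at hw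
      exact hρ1 ((mem_sphere_iff_norm.mp hw).symm.trans ha')
    have hi : CircleIntegrable (fun w => (w - a)⁻¹) 1 ρ :=
      ContinuousOn.circleIntegrable hρ0.le
        ((continuousOn_id.sub continuousOn_const).inv₀ hne)
    have hi' : CircleIntegrable (fun w => F a • (w - a)⁻¹) 1 ρ := hi.const_smul
    rw [← smul_eq_mul (F a), ← circleIntegral.integral_smul, ← circleIntegral.integral_add
      (ContinuousOn.circleIntegrable hρ0.le (hd.continuousOn.mono hρ)) hi']
    refine circleIntegral.integral_congr hρ0.le fun w hw => ?_
    have hwa := hne w hw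
    simp only [smul_eq_mul]
    rw [dslope_of_ne F (sub_ne_zero.mp hwa), slope_def_field]
    field_simp
    ring
  rw [key R (by linarith) hR.ne' h.sphere_outer_subset, key r hr0 hr1.ne h.sphere_inner_subset,
    h.circleIntegral_eq hN hd,
    circleIntegral.integral_sub_inv_of_mem_ball (mem_ball_iff_norm.mpr (by linarith)),
    Complex.circleIntegral_eq_zero_of_differentiable_on_off_countable (R := r)
      (f := fun w => (w - a)⁻¹) hr0.le countable_empty]
  · ring
  · refine (continuousOn_id.sub continuousOn_const).inv₀ fun w hw hwa => ?_
    have := mem_closedBall_iff_norm.mp hw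
    rw [show w = a from sub_eq_zero.mp hwa] at this
    linarith
  · intro w hw
    refine DifferentiableAt.inv (by fun_prop) fun hwa => ?_
    have := mem_ball_iff_norm.mp hw.1
    rw [sub_eq_zero.mp hwa] at this
    linarith

lemma annulusKernel_integral (h : IsAdmissibleAnnulus N r R) (hF : DifferentiableOn ℂ F N)
    {φ : ℝ → ℂ} (hφ : IsHalfBounded φ) :
    IntegrableOn (fun u => annulusKernel F r R u * φ u) (Ioi 0) ∧
    ∫ u in Ioi (0 : ℝ), annulusKernel F r R u * φ u = (2 * (Real.pi : ℂ) * Complex.I)⁻¹ *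
      ((∮ w in C(1, R), F w * (w ^ 2)⁻¹ * ∫ u in Ioi (0 : ℝ), lowKernel w⁻¹ u * φ u) -
        ∮ w in C(1, r), F w * (w ^ 2)⁻¹ * ∫ u in Ioi (0 : ℝ), highKernel w⁻¹ u * φ u) :=
  _root_.annulusKernel_integral h.1 h.2.1 h.2.2.1 (hF.continuousOn.mono h.sphere_inner_subset)
    (hF.continuousOn.mono h.sphere_outer_subset) hφ

lemma kernelCondB (h : IsAdmissibleAnnulus N r R) (hF : DifferentiableOn ℂ F N) :
    KernelCondB (annulusKernel F r R) :=
  (h.annulusKernel_integral hF isHalfBounded_rpow).1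

lemma measurable_annulusKernel (h : IsAdmissibleAnnulus N r R) (hF : DifferentiableOn ℂ F N) :
    Measurable (annulusKernel F r R) :=
  _root_.measurable_annulusKernel h.1 h.2.1 h.2.2.1 (hF.continuousOn.mono h.sphere_inner_subset)
    (hF.continuousOn.mono h.sphere_outer_subset)

lemma inv_mem_sphere {z : ℂ} (hz : z.re = 1 / 2) : z⁻¹ ∈ Metric.sphere (1 : ℂ) 1 := by
  have hz0 : z ≠ 0 := fun h => by simp [h] at hz
  have e : z⁻¹ - 1 = (1 - z) / z := by field_simp
  rw [mem_sphere_iff_norm, e, norm_div, div_eq_one_iff_eq (norm_ne_zero_iff.mpr hz0),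
    ← sq_eq_sq₀ (norm_nonneg _) (norm_nonneg _), ← Complex.normSq_eq_norm_sq,
    ← Complex.normSq_eq_norm_sq, Complex.normSq_apply, Complex.normSq_apply]
  simp [hz]
  norm_num

lemma zero_mem_sphere : (0 : ℂ) ∈ Metric.sphere (1 : ℂ) 1 := by simp

/-- Partial fractions give w⁻²(z - w⁻¹)⁻¹ = (w - z⁻¹)⁻¹ - w⁻¹. Both poles z⁻¹ and 0 lie on 𝕋 + 1,
hence in the annulus, and Cauchy's formula at each gives the two terms. -/
lemma mellin_annulusKernel (h : IsAdmissibleAnnulus N r R) (hN : IsOpen N)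
    (hF : DifferentiableOn ℂ F N) {z : ℂ} (hz : z.re = 1 / 2) :
    mellin (annulusKernel F r R) z = F z⁻¹ - F 0 := by
  have hr0 := h.1
  have hr1 := h.2.1
  have hR := h.2.2.1
  have hz0 : z ≠ 0 := fun h => by simp [h] at hz
  have hm : ∀ J : ℝ → ℂ, ∫ u in Ioi (0 : ℝ), J u * (u : ℂ) ^ (z - 1) = mellin J z := by
    intro J
    simp only [mellin, smul_eq_mul, mul_comm]
  have h1 := (h.annulusKernel_integral hF (isHalfBounded_cpow hz)).2
  simp only [hm] at h1
  have hne : ∀ ρ : ℝ, ρ ≠ 1 → ∀ a ∈ Metric.sphere (1 : ℂ) 1, ∀ w ∈ Metric.sphere (1 : ℂ) ρ,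
      w - a ≠ 0 := by
    intro ρ hρ1 a ha w hw hwa
    rw [sub_eq_zero.mp hwa] at hw
    exact hρ1 ((mem_sphere_iff_norm.mp hw).symm.trans (mem_sphere_iff_norm.mp ha))
  have key : ∀ ρ : ℝ, 0 < ρ → ρ ≠ 1 → Metric.sphere 1 ρ ⊆ N →
      ∀ κ : ℂ → ℝ → ℂ, (∀ w ∈ Metric.sphere (1 : ℂ) ρ, mellin (κ w⁻¹) z = (z - w⁻¹)⁻¹) →
      ∮ w in C(1, ρ), F w * (w ^ 2)⁻¹ * mellin (κ w⁻¹) z =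
        (∮ w in C(1, ρ), F w * (w - z⁻¹)⁻¹) - ∮ w in C(1, ρ), F w * (w - 0)⁻¹ := by
    intro ρ hρ0 hρ1 hρ κ hκ
    have hi : ∀ a ∈ Metric.sphere (1 : ℂ) 1,
        CircleIntegrable (fun w => F w * (w - a)⁻¹) 1 ρ := fun a ha =>
      ContinuousOn.circleIntegrable hρ0.le ((hF.continuousOn.mono hρ).mul
        ((continuousOn_id.sub continuousOn_const).inv₀ (hne ρ hρ1 a ha)))
    rw [← circleIntegral.integral_sub (hi _ (inv_mem_sphere hz)) (hi _ zero_mem_sphere)]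
    refine circleIntegral.integral_congr hρ0.le fun w hw => ?_
    have hw1 := hne ρ hρ1 _ (inv_mem_sphere hz) w hw
    have hw0 : w ≠ 0 := by simpa using hne ρ hρ1 _ zero_mem_sphere w hw
    have e : z - w⁻¹ = z * w⁻¹ * (w - z⁻¹) := by field_simp
    have e2 : (w - z⁻¹)⁻¹ - w⁻¹ = z⁻¹ * w⁻¹ * (w - z⁻¹)⁻¹ := by
      rw [inv_sub_inv hw1 hw0, sub_sub_cancel, div_eq_mul_inv, mul_inv]
      ring
    simp only [sub_zero]
    rw [hκ w hw, ← mul_sub, e2, e, mul_inv, mul_inv, inv_inv]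
    field_simp
  rw [key R (by linarith) hR.ne' h.sphere_outer_subset lowKernel (fun w hw =>
      mellin_lowKernel (inv_re_lt_half (by rwa [mem_sphere_iff_norm.mp hw])).2 hz),
    key r hr0 hr1.ne h.sphere_inner_subset highKernel (fun w hw =>
      mellin_highKernel (half_lt_inv_re (by rwa [mem_sphere_iff_norm.mp hw])).2 hz)] at h1
  rw [h1]
  have c1 := h.cauchy hN hF (inv_mem_sphere hz)
  have c2 := h.cauchy hN hF zero_mem_sphere
  have hpi : 2 * (Real.pi : ℂ) * Complex.I ≠ 0 := Complex.two_pi_I_ne_zero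
  rw [inv_mul_eq_iff_eq_mul₀ hpi, mul_sub, ← c1, ← c2]
  ring

end IsAdmissibleAnnulus

/-! ### The functional calculus through matrix coefficients -/

/-- Continuous linear functionals commute with circle integrals. -/
lemma map_circleIntegral {E : Type*} [NormedAddCommGroup E] [NormedSpace ℂ E] [CompleteSpace E]
    (ℓ : E →L[ℂ] ℂ) {f : ℂ → E} {c : ℂ} {ρ : ℝ} (hf : CircleIntegrable f c ρ) :
    ℓ (∮ w in C(c, ρ), f w) = ∮ w in C(c, ρ), ℓ (f w) := by
  simp only [circleIntegral]
  rw [← ContinuousLinearMap.intervalIntegral_comp_comm ℓ hf.out]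
  simp only [map_smul]

/-- The matrix coefficient `T ↦ ⟪g, T f⟫`. -/
noncomputable def matrixCoeff (g f : L2Rplus) : (L2Rplus →L[ℂ] L2Rplus) →L[ℂ] ℂ :=
  (innerSL ℂ g).comp (ContinuousLinearMap.apply ℂ L2Rplus f)

lemma matrixCoeff_apply (g f : L2Rplus) (T : L2Rplus →L[ℂ] L2Rplus) :
    matrixCoeff g f T = inner ℂ g (T f) := rfl

lemma matrixCoeff_resolvent {w : ℂ} {κ : ℝ → ℂ} (ha : KernelCondA κ) (hb : KernelCondB κ)
    (hres : resolvent cesaroPlus w = w⁻¹ • 1 + (w ^ 2)⁻¹ • hausdorffPlus κ ha hb)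
    (g f : L2Rplus) :
    matrixCoeff g f (resolvent cesaroPlus w) = w⁻¹ * inner ℂ g f +
      (w ^ 2)⁻¹ * ∫ u in Ioi (0 : ℝ), κ u * dilationCoeff (g : L2R) (f : L2R) u := by
  rw [hres, map_add, map_smul, map_smul, matrixCoeff_apply, matrixCoeff_apply,
    inner_hausdorffPlus, smul_eq_mul, smul_eq_mul, one_apply_eq_self]

lemma continuousOn_resolvent {A : Type*} [NormedRing A] [NormedAlgebra ℂ A] [CompleteSpace A]
    (a : A) : ContinuousOn (resolvent a) (resolventSet ℂ a) :=
  fun _ hw => (spectrum.hasDerivAt_resolvent_const_left hw).continuousAt.continuousWithinAt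

lemma circleIntegrable_resolvent {F : ℂ → ℂ} {ρ : ℝ} (hρ0 : 0 < ρ) (hρ1 : ρ ≠ 1)
    (hF : ContinuousOn F (Metric.sphere 1 ρ)) :
    CircleIntegrable (fun w => F w • resolvent cesaroPlus w) 1 ρ := by
  refine ContinuousOn.circleIntegrable hρ0.le
    (hF.smul ((continuousOn_resolvent cesaroPlus).mono fun w hw => ?_))
  by_contra hcon
  have := mem_sphere_iff_norm.mp (spectrum_cesaroPlus_subset hcon)
  exact hρ1 ((mem_sphere_iff_norm.mp hw).symm.trans this)

/-- The Riesz–Dunford integral of `F` at `𝒞₊` is `F(0) + 𝓗_K` for the kernel `annulusKernel`. -/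
lemma IsAdmissibleAnnulus.inner_annulusCalculus {N : Set ℂ} {r R : ℝ} {F : ℂ → ℂ}
    (h : IsAdmissibleAnnulus N r R) (hN : IsOpen N) (hF : DifferentiableOn ℂ F N)
    (g f : L2Rplus) :
    inner ℂ g (annulusCalculus F r R cesaroPlus f) = F 0 * inner ℂ g f +
      ∫ u in Ioi (0 : ℝ), annulusKernel F r R u * dilationCoeff (g : L2R) (f : L2R) u := by
  have hr0 := h.1
  have hr1 := h.2.1
  have hR := h.2.2.1
  have hFr := hF.continuousOn.mono h.sphere_inner_subset
  have hFR := hF.continuousOn.mono h.sphere_outer_subset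
  have hφ := isHalfBounded_dilationCoeff (g : L2R) (f : L2R)
  have key : ∀ ρ : ℝ, 0 < ρ → ρ ≠ 1 → Metric.sphere 1 ρ ⊆ N → ∀ I : ℂ → ℂ,
      CircleIntegrable (fun w => F w * (w ^ 2)⁻¹ * I w) 1 ρ →
      (∀ w ∈ Metric.sphere (1 : ℂ) ρ, matrixCoeff g f (resolvent cesaroPlus w) =
        w⁻¹ * inner ℂ g f + (w ^ 2)⁻¹ * I w) →
      matrixCoeff g f (∮ w in C(1, ρ), F w • resolvent cesaroPlus w) =
        (∮ w in C(1, ρ), F w * (w - 0)⁻¹) * inner ℂ g f +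
          ∮ w in C(1, ρ), F w * (w ^ 2)⁻¹ * I w := by
    intro ρ hρ0 hρ1 hρ I hI hres
    have hFρ := hF.continuousOn.mono hρ
    have hi : CircleIntegrable (fun w => F w * (w - 0)⁻¹) 1 ρ :=
      ContinuousOn.circleIntegrable hρ0.le (hFρ.mul
        ((continuousOn_id.sub continuousOn_const).inv₀ fun w hw => by
          simpa using ne_zero_of_mem_sphere_one hρ1 hw))
    have hi' : CircleIntegrable (fun w => (inner ℂ g f : ℂ) • (F w * (w - 0)⁻¹)) 1 ρ :=
      hi.const_smul
    rw [map_circleIntegral _ (circleIntegrable_resolvent hρ0 hρ1 hFρ), mul_comm,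
      ← smul_eq_mul (inner ℂ g f), ← circleIntegral.integral_smul,
      ← circleIntegral.integral_add hi' hI]
    refine circleIntegral.integral_congr hρ0.le fun w hw => ?_
    simp only [smul_eq_mul, sub_zero]
    rw [map_smul, hres w hw, smul_eq_mul]
    ring
  have e1 := key R (by linarith) hR.ne' h.sphere_outer_subset _ (circleKernel_low hR hFR hφ).2.1
    (fun w hw => by
      have hw' : 1 < ‖w - 1‖ := by rwa [mem_sphere_iff_norm.mp hw]
      exact matrixCoeff_resolvent _ _ (resolvent_cesaroPlus_of_gt hw').2 g f)
  have e2 := key r hr0 hr1.ne h.sphere_inner_subset _ (circleKernel_high hr0 hr1 hFr hφ).2.1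
    (fun w hw => by
      have hw' : ‖w - 1‖ < 1 := by rwa [mem_sphere_iff_norm.mp hw]
      exact matrixCoeff_resolvent _ _ (resolvent_cesaroPlus_of_lt hw').2 g f)
  -- The scalar parts w⁻¹ of the resolvent are collected by Cauchy's formula at 0, which produces
  -- F(0)I.
  have c := h.cauchy hN hF IsAdmissibleAnnulus.zero_mem_sphere
  rw [← matrixCoeff_apply, annulusCalculus, map_smul, map_sub, e1, e2,
    (h.annulusKernel_integral hF hφ).2, smul_eq_mul, add_sub_add_comm, ← sub_mul, c, mul_add]
  congr 1
  rw [mul_assoc _ (F 0), inv_mul_cancel_left₀ Complex.two_pi_I_ne_zero]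

/-- A kernel with Mellin transform `F(z⁻¹)` represents `F(𝒞₊)`, if `F(0) = 0`. -/
lemma IsAdmissibleAnnulus.annulusCalculus_eq {N : Set ℂ} {r R : ℝ} {F : ℂ → ℂ}
    (h : IsAdmissibleAnnulus N r R) (hN : IsOpen N) (hF : DifferentiableOn ℂ F N) (hF0 : F 0 = 0)
    {K : ℝ → ℂ} (ha : KernelCondA K) (hb : KernelCondB K) (hc : KernelCondC F K) :
    annulusCalculus F r R cesaroPlus = hausdorffPlus K ha hb := by
  ext1 f
  refine ext_inner_left ℂ fun g => ?_
  rw [h.inner_annulusCalculus hN hF, inner_hausdorffPlus, hF0, zero_mul, zero_add]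
  -- Condition (c) does not involve r and R, so by uniqueness the kernels of all admissible annuli
  -- agree with K a.e. on ℝ₊.
  have hae := (h.kernelCondB hF).ae_eq_of_mellin_eq hb (fun z hz => by
    rw [h.mellin_annulusKernel hN hF hz, hc z hz, hF0, sub_zero])
  apply integral_congr_ae
  filter_upwards [hae] with u hu
  rw [hu]

/-- Condition (c) forces `F(0) = 0`, by the Riemann–Lebesgue lemma. -/
lemma KernelCondC.apply_zero {F : ℂ → ℂ} {K : ℝ → ℂ} (hc : KernelCondC F K)
    (hF : ContinuousAt F 0) : F 0 = 0 := by
  have h1 : Filter.Tendsto (fun t : ℝ => (1 / 2 + t * Complex.I : ℂ)⁻¹) Filter.atTop (nhds 0) := by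
    refine Filter.tendsto_inv₀_cobounded.comp (tendsto_norm_atTop_iff_cobounded.mp ?_)
    refine Filter.tendsto_atTop_mono (fun t => ?_) Filter.tendsto_id
    have := Complex.abs_im_le_norm (1 / 2 + t * Complex.I : ℂ)
    simp only [Complex.add_im, Complex.mul_im, Complex.ofReal_re, Complex.I_im, Complex.ofReal_im,
      Complex.I_re] at this
    norm_num at this
    exact (le_abs_self t).trans (by simpa using this)
  have h2 : Filter.Tendsto (fun t : ℝ => F (1 / 2 + t * Complex.I : ℂ)⁻¹) Filter.atTop
      (nhds (F 0)) := Filter.Tendsto.comp hF h1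
  have h3 := tendsto_mellin_critical_line K
  refine tendsto_nhds_unique h2 (h3.congr fun t => hc _ (by simp))

theorem mainTheorem6 :
    spectrum ℂ cesaroPlus ⊆ Metric.sphere (1 : ℂ) 1 ∧
    ∀ (F : ℂ → ℂ) (N : Set ℂ), IsOpen N → Metric.sphere (1 : ℂ) 1 ⊆ N → DifferentiableOn ℂ F N →
      (F 0 = 0 →
        ∃ (K : ℝ → ℂ) (ha : KernelCondA K) (hb : KernelCondB K),
          Measurable K ∧ KernelCondC F K ∧
          ∀ r R : ℝ, IsAdmissibleAnnulus N r R →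
            annulusCalculus F r R cesaroPlus = hausdorffPlus K ha hb) ∧
      (∀ (K : ℝ → ℂ) (ha : KernelCondA K) (hb : KernelCondB K), KernelCondC F K →
        F 0 = 0 ∧
        ∀ r R : ℝ, IsAdmissibleAnnulus N r R →
          hausdorffPlus K ha hb = annulusCalculus F r R cesaroPlus) := by
  refine ⟨spectrum_cesaroPlus_subset, fun F N hN hsub hF => ⟨fun hF0 => ?_, fun K ha hb hc => ?_⟩⟩
  · obtain ⟨r, R, h⟩ := exists_isAdmissibleAnnulus hN hsub
    have hc : KernelCondC F (annulusKernel F r R) := fun z hz => by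
      rw [h.mellin_annulusKernel hN hF hz, hF0, sub_zero]
    -- K is built from one annulus; its Mellin transform alone gives the formula for every other
    -- annulus.
    exact ⟨annulusKernel F r R, kernelCondA_annulusKernel, h.kernelCondB hF,
      h.measurable_annulusKernel hF, hc, fun r' R' h' => h'.annulusCalculus_eq hN hF hF0 _ _ hc⟩
  · have hF0 : F 0 = 0 := hc.apply_zero
      (hF.continuousOn.continuousAt (hN.mem_nhds (hsub IsAdmissibleAnnulus.zero_mem_sphere)))
    exact ⟨hF0, fun r R h => (h.annulusCalculus_eq hN hF hF0 ha hb hc).symm⟩
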